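/- Let $F$ be a field of characteristic different from $2$. **Cyclic compositions.** A cyclic composition (of dimension $8$) over $F$ is a tuple $\Gamma=(V,L,Q,\rho,*)$, where $L$ is a cubic étale $F$-algebra, $\rho$ is an $F$-automorphism of $L$ of order $3$, $V$ is a free $L$-module of rank $8$, $Q\colon V\to L$ is a quadratic form with nondegenerate polar form $b_Q$, and $*\colon V\times V\to V$ is an $F$-bilinear map such that for all $x,y,z\in V$, $\lambda\in L$ $$(\lambda x)*y=\rho(\lambda)(x*y),\quad x*(\lambda y)=\rho^2(\lambda)(x*y),\quad Q(x*y)=\rho(Q(x))\,\rho^2(Q(y)),$$ $$b_Q(x*y,z)=\rho(b_Q(y*z,x))=\rho^2(b_Q(z*x,y)).$$ An isotopy $\Gamma\to\Gamma'$ is a pair $(\nu,f)$, where $\nu\colon L\to L'$ is an $F$-algebra isomorphism with $\nu\rho=\rho'\nu$ and $f\colon V\to V'$ is a $\nu$-semilinear bijection, such that for some $\mu\in L^\times$ and all $x,y\in V$ $$Q'(f(x))=\nu\bigl(\rho(\mu)\rho^2(\mu)Q(x)\bigr),\qquad f(x)*'f(y)=\nu(\mu)f(x*y).$$ It is called $L$-linear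 if $L'=L$ and $\nu=\mathrm{Id}_L$. **Symmetric compositions.** A symmetric composition (of dimension $8$) over $F$ is a triple $\Sigma=(S,n,\star)$, where $S$ is an $8$-dimensional $F$-vector space, $n$ is a quadratic form on $S$ with nondegenerate polar form $b_n$, and $\star$ is an $F$-bilinear product on $S$ with $n(x\star y)=n(x)n(y)$ and $b_n(x\star y,z)=b_n(x,y\star z)$. Isomorphisms are linear bijections that preserve $n$ and $\star$. Put $\widehat\rho=\mathrm{Id}_S\otimes\rho$ on $S\otimes_FL$, and let $\Sigma\otimes(L,\rho)=(S\otimes_FL,L,n_L,\rho,*)$ be the cyclic composition with $x*y=\widehat\rho(x)\star_L\widehat\rho^{\,2}(y)$, where $n_L$ and $\star_L$ are the extensions of $n$ and $\star$ to $L$. A cyclic composition is induced if it is isotopic to some $\Sigma\otimes(L,\rho)$. **The algebra $\operatorname{End}\Gamma$.** Let $\Gamma=(V,L,Q,\rho,*)$ be a cyclic composition over $F$ with $L$ a field, and let $\theta=\rho^2$. For $\nu\in\{\rho,\theta\}$ let ${}^\nu V=\{{}^\nu x\mid x\in V\}$ be the twisted $L$-space with ${}^\nu(\lambda x)=\nu(\lambda)\,{}^\nu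 x$, and identify $\operatorname{End}_L({}^\nu V)$ with ${}^\nu(\operatorname{End}_LV)$ by ${}^\nu g({}^\nu x)={}^\nu(g(x))$. For $x\in V$ define $\ell_x\colon{}^\rho V\to{}^\theta V$, ${}^\rho y\mapsto{}^\theta(x*y)$, and $r_x\colon{}^\theta V\to{}^\rho V$, ${}^\theta z\mapsto{}^\rho(z*x)$. The map $x\mapsto\bigl(({}^\rho y,{}^\theta z)\mapsto(r_x({}^\theta z),\ell_x({}^\rho y))\bigr)$ extends to an $L$-algebra homomorphism $C(V,Q)\to\operatorname{End}_L({}^\rho V\oplus{}^\theta V)$, which restricts to $$\alpha_{*0}\colon C_0(V,Q)\to\operatorname{End}_L({}^\rho V)\times\operatorname{End}_L({}^\theta V).$$ Let $\sigma_Q$ be the involution of $\operatorname{End}_LV$ adjoint to $Q$, and identify the Clifford algebra $C(\operatorname{End}_LV,\sigma_Q)$ with $C_0(V,Q)$, the canonical map from $\operatorname{End}_LV$ sending $\bigl(z\mapsto x\,b_Q(y,z)\bigr)$ to $x\cdot y$. The trialitarian algebra of $\Gamma$ is $\operatorname{End}\Gamma=(\operatorname{End}_LV,L,\sigma_Q,\alpha_{*0})$.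 Its automorphism group $\operatorname{Aut}_F(\operatorname{End}\Gamma)$ consists of the $F$-algebra automorphisms $\varphi$ of $\operatorname{End}_LV$ that commute with $\sigma_Q$, restrict on the center $L$ to an automorphism commuting with $\rho$, and satisfy $({}^\rho\varphi\times{}^\theta\varphi)\circ\alpha_{*0}=\alpha_{*0}\circ C(\varphi)$, where $C(\varphi)$ is the automorphism of $C(\operatorname{End}_LV,\sigma_Q)$ induced by $\varphi$. **Theorem.** Let $\Gamma=(V,L,Q,\rho,*)$ be a cyclic composition over $F$ with $L$ a field. (i) Let $\Sigma$ be a symmetric composition over $F$ and $f\colon\Sigma\otimes(L,\rho)\to\Gamma$ an $L$-linear isotopy. Then $\tau_{(\Sigma,f)}\colon g\mapsto(f\widehat\rho f^{-1})\circ g\circ(f\widehat\rho f^{-1})^{-1}$ belongs to $\operatorname{Aut}_F(\operatorname{End}\Gamma)$, and $\tau_{(\Sigma,f)}^3=\mathrm{Id}$ and $\tau_{(\Sigma,f)}|_L=\rho$. Up to conjugation in $\operatorname{Aut}_F(\operatorname{End}\Gamma)$, it depends only on the isomorphism class of $\Sigma$: if $\Sigma\cong\Sigma'$ and $f'\colon\Sigma'\otimes(L,\rho)\to\Gamma$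 is an $L$-linear isotopy, then $\tau_{(\Sigma',f')}$ is conjugate to $\tau_{(\Sigma,f)}$ in $\operatorname{Aut}_F(\operatorname{End}\Gamma)$. (ii) Let $\tau\in\operatorname{Aut}_F(\operatorname{End}\Gamma)$ satisfy $\tau|_L=\rho$ and $\tau^3=\mathrm{Id}$. Then $\Gamma$ is induced. More precisely, there are a symmetric composition $\Sigma$ over $F$ and an $L$-linear isotopy $f\colon\Sigma\otimes(L,\rho)\to\Gamma$ such that $\tau=\tau_{(\Sigma,f)}$. -/

import Mathlib

universe u v w s s'

open scoped TensorProduct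

/-- A cubic étale `F`-algebra `L` together with an `F`-automorphism `ρ` of `L` of order 3. -/
structure CubicAlgebraWithAut (F L : Type*) [Field F] [CommRing L] [Algebra F L] where
  etale : Algebra.Etale F L
  finrank_eq : Module.finrank F L = 3
  ρ : L ≃ₐ[F] L
  orderOf_ρ : orderOf ρ = 3

namespace CubicAlgebraWithAut

variable {F L : Type*} [Field F] [CommRing L] [Algebra F L] (A : CubicAlgebraWithAut F L)

/-- The automorphism `θ = ρ²`. -/
def θ : L ≃ₐ[F] L := A.ρ ^ 2

theorem θ_apply (l : L) : A.θ l = A.ρ (A.ρ l) := by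
  simp [θ, pow_two]

theorem ρ_ρ_ρ (l : L) : A.ρ (A.ρ (A.ρ l)) = l := by
  have h : A.ρ ^ 3 = 1 := by rw [← A.orderOf_ρ]; exact pow_orderOf_eq_one _
  have := DFunLike.congr_fun h l
  simpa [pow_succ] using this

theorem ρ_symm_apply (l : L) : A.ρ.symm l = A.ρ (A.ρ l) := by
  rw [AlgEquiv.symm_apply_eq, A.ρ_ρ_ρ]

theorem θ_symm_apply (l : L) : A.θ.symm l = A.ρ l := by
  rw [AlgEquiv.symm_apply_eq, θ_apply, A.ρ_ρ_ρ]

end CubicAlgebraWithAut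

/-- A cyclic composition `(V, L, Q, ρ, *)` of dimension 8 over the field `F`. -/
structure CyclicComposition (F L V : Type*) [Field F] [CommRing L] [Algebra F L]
    [AddCommGroup V] [Module F V] [Module L V] [IsScalarTower F L V]
    extends CubicAlgebraWithAut F L where
  free : Module.Free L V
  finrank_module : Module.finrank L V = 8
  Q : QuadraticForm L V
  nondegenerate : LinearMap.BilinForm.Nondegenerate Q.polarBilin
  /-- the product `*` -/
  mul : V →ₗ[F] V →ₗ[F] V
  smul_mul : ∀ (l : L) (x y : V), mul (l • x) y = ρ l • mul x y
  mul_smul : ∀ (l : L) (x y : V), mul x (l • y) = (ρ ^ 2) l • mul x y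
  Q_mul : ∀ x y : V, Q (mul x y) = ρ (Q x) * (ρ ^ 2) (Q y)
  polar_mul : ∀ x y z : V, Q.polarBilin (mul x y) z = ρ (Q.polarBilin (mul y z) x)
  polar_mul' : ∀ x y z : V, Q.polarBilin (mul x y) z = (ρ ^ 2) (Q.polarBilin (mul z x) y)

/-- A pair `(ν, f)` is an isotopy `Γ → Γ'` of cyclic compositions: `ν : (L, ρ) ≃ (L', ρ')`, and `f`
is a `ν`-semilinear isomorphism satisfying the two identities for some multiplier `μ`. -/
structure CyclicComposition.IsIsotopy {F L L' V V' : Type*} [Field F]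
    [CommRing L] [Algebra F L] [AddCommGroup V] [Module F V] [Module L V] [IsScalarTower F L V]
    [CommRing L'] [Algebra F L'] [AddCommGroup V'] [Module F V'] [Module L' V']
    [IsScalarTower F L' V']
    (Γ : CyclicComposition F L V) (Γ' : CyclicComposition F L' V')
    (ν : L ≃ₐ[F] L') (f : V ≃ₗ[F] V') : Prop where
  comm : ∀ l : L, ν (Γ.ρ l) = Γ'.ρ (ν l)
  semilinear : ∀ (l : L) (x : V), f (l • x) = ν l • f x
  exists_multiplier : ∃ μ : Lˣ,
    (∀ x : V, Γ'.Q (f x) = ν (Γ.ρ μ * (Γ.ρ ^ 2) μ * Γ.Q x)) ∧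
    ∀ x y : V, Γ'.mul (f x) (f y) = ν μ • f (Γ.mul x y)

/-- An `L`-linear isotopy is an isotopy `(Id, f)`. -/
abbrev CyclicComposition.IsLinearIsotopy {F L V V' : Type*} [Field F]
    [CommRing L] [Algebra F L] [AddCommGroup V] [Module F V] [Module L V] [IsScalarTower F L V]
    [AddCommGroup V'] [Module F V'] [Module L V'] [IsScalarTower F L V']
    (Γ : CyclicComposition F L V) (Γ' : CyclicComposition F L V') (f : V ≃ₗ[F] V') : Prop :=
  Γ.IsIsotopy Γ' AlgEquiv.refl f

/-- A symmetric composition `(S, n, ⋆)` of dimension 8 over the field `F`. -/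
structure SymmetricComposition (F S : Type*) [Field F] [AddCommGroup S] [Module F S] where
  finrank_eq : Module.finrank F S = 8
  n : QuadraticForm F S
  nondegenerate : LinearMap.BilinForm.Nondegenerate n.polarBilin
  /-- the product `⋆` -/
  mul : S →ₗ[F] S →ₗ[F] S
  n_mul : ∀ x y : S, n (mul x y) = n x * n y
  polar_mul : ∀ x y z : S, n.polarBilin (mul x y) z = n.polarBilin x (mul y z)

/-- Isomorphisms of symmetric compositions (isotopies with multiplier 1). -/
structure SymmetricComposition.IsIsomorphism {F S S' : Type*} [Field F]
    [AddCommGroup S] [Module F S] [AddCommGroup S'] [Module F S']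
    (Sg : SymmetricComposition F S) (Sg' : SymmetricComposition F S') (e : S ≃ₗ[F] S') : Prop where
  map_n : ∀ x : S, Sg'.n (e x) = Sg.n x
  map_mul : ∀ x y : S, Sg'.mul (e x) (e y) = e (Sg.mul x y)

/-- `Σ ≅ Σ'`. -/
def SymmetricComposition.Isomorphic {F S S' : Type*} [Field F]
    [AddCommGroup S] [Module F S] [AddCommGroup S'] [Module F S']
    (Sg : SymmetricComposition F S) (Sg' : SymmetricComposition F S') : Prop :=
  ∃ e : S ≃ₗ[F] S', Sg.IsIsomorphism Sg' e

section Induced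

variable {F L S : Type*} [Field F] [CommRing L] [Algebra F L] [AddCommGroup S] [Module F S]

/-- The map `ν ⊗ Id` on `L ⊗ S` for an automorphism `ν` of `L`. -/
noncomputable def hatMap (S : Type*) [AddCommGroup S] [Module F S] (ν : L ≃ₐ[F] L) :
    L ⊗[F] S ≃ₗ[F] L ⊗[F] S :=
  TensorProduct.congr ν.toLinearEquiv (LinearEquiv.refl F S)

@[simp] theorem hatMap_tmul (ν : L ≃ₐ[F] L) (l : L) (s : S) :
    hatMap S ν (l ⊗ₜ[F] s) = ν l ⊗ₜ[F] s := rfl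

theorem hatMap_smul (ν : L ≃ₐ[F] L) (l : L) (x : L ⊗[F] S) :
    hatMap S ν (l • x) = ν l • hatMap S ν x := by
  induction x using TensorProduct.induction_on with
  | zero => simp
  | tmul a s => simp [TensorProduct.smul_tmul']
  | add x y hx hy => simp [hx, hy]

/-- The `L`-bilinear extension of an `F`-bilinear product on `S` to `L ⊗ S`. -/
noncomputable def extendMul (L : Type*) [CommRing L] [Algebra F L] (m : S →ₗ[F] S →ₗ[F] S) :
    L ⊗[F] S →ₗ[L] L ⊗[F] S →ₗ[L] L ⊗[F] S :=
  LinearMap.BilinMap.baseChange L m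

@[simp] theorem extendMul_tmul (m : S →ₗ[F] S →ₗ[F] S) (a b : L) (x y : S) :
    extendMul L m (a ⊗ₜ[F] x) (b ⊗ₜ[F] y) = (a * b) ⊗ₜ[F] m x y := rfl

variable [Invertible (2 : F)]

theorem polar_baseChange_tmul (n : QuadraticForm F S) (a b : L) (x y : S) :
    (n.baseChange L).polarBilin (a ⊗ₜ[F] x) (b ⊗ₜ[F] y) = n.polarBilin x y • (a * b) := by
  let : Invertible (2 : L) := (Invertible.map (algebraMap F L) 2).copy 2 (map_ofNat _ _).symm
  rw [QuadraticForm.polarBilin_baseChange, LinearMap.BilinForm.baseChange_tmul]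

theorem polar_self {R M : Type*} [CommRing R] [AddCommGroup M] [Module R M] (q : QuadraticForm R M)
    (x : M) : q.polarBilin x x = 2 * q x := by
  simp [QuadraticMap.polar_self]

theorem nondegenerate_baseChange (n : QuadraticForm F S) (hf : Module.Finite F S)
    (h : LinearMap.BilinForm.Nondegenerate n.polarBilin) :
    LinearMap.BilinForm.Nondegenerate (n.baseChange L).polarBilin := by
  classical
  have key : ∀ x : L ⊗[F] S, (∀ y, (n.baseChange L).polarBilin x y = 0) → x = 0 := by
    intro x hx
    let e := Module.finBasis F S
    let e' := LinearMap.BilinForm.dualBasis n.polarBilin h e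
    let E := e.baseChange L
    let E' := e'.baseChange L
    apply E'.ext_elem
    intro i
    have h1 := hx (E i)
    rw [← E'.sum_repr x] at h1
    simp only [map_sum, map_smul, LinearMap.sum_apply, LinearMap.smul_apply, E', E,
      Module.Basis.baseChange_apply, polar_baseChange_tmul, e',
      LinearMap.BilinForm.apply_dualBasis_left] at h1
    simpa using h1
  refine ⟨key, fun y hy => key y fun x => ?_⟩
  have := hy x
  simp only [QuadraticMap.polarBilin_apply_apply] at this ⊢
  rw [QuadraticMap.polar_comm, this]

end Induced

namespace SymmetricComposition

variable {F L S : Type*} [Field F] [CommRing L] [Algebra F L] [AddCommGroup S] [Module F S]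
  (Sg : SymmetricComposition F S)

theorem polar_mul_left (x y z : S) : Sg.n.polarBilin (Sg.mul x y) (Sg.mul x z)
    = Sg.n x * Sg.n.polarBilin y z := by
  simp only [QuadraticMap.polarBilin_apply_apply, QuadraticMap.polar, ← map_add, Sg.n_mul]
  ring

theorem polar_mul_mul (x x' y z : S) : Sg.n.polarBilin (Sg.mul x y) (Sg.mul x' z)
      + Sg.n.polarBilin (Sg.mul x' y) (Sg.mul x z)
    = Sg.n.polarBilin x x' * Sg.n.polarBilin y z := by
  have h := Sg.polar_mul_left (x + x') y z
  have h1 := Sg.polar_mul_left x y z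
  have h2 := Sg.polar_mul_left x' y z
  have h3 : Sg.n.polarBilin x x' = Sg.n (x + x') - Sg.n x - Sg.n x' := rfl
  simp only [map_add, LinearMap.add_apply] at h
  linear_combination h - h1 - h2 - h3 * Sg.n.polarBilin y z

theorem hatMap_extendMul (ν : L ≃ₐ[F] L) (x y : L ⊗[F] S) :
    hatMap S ν (extendMul L Sg.mul x y) = extendMul L Sg.mul (hatMap S ν x) (hatMap S ν y) := by
  induction x using TensorProduct.induction_on with
  | zero => simp only [map_zero, LinearMap.zero_apply]
  | add u v hu hv => simp only [map_add, LinearMap.add_apply, hu, hv]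
  | tmul a s =>
  induction y using TensorProduct.induction_on with
  | zero => simp only [map_zero]
  | add u v hu hv => simp only [map_add, hu, hv]
  | tmul b t => simp

/-- The product `x * y = (Id ⊗ ρ)(x) ⋆ (Id ⊗ ρ²)(y)` on `L ⊗ S`. -/
noncomputable def inducedMul (ρ : L ≃ₐ[F] L) : L ⊗[F] S →ₗ[F] L ⊗[F] S →ₗ[F] L ⊗[F] S :=
  LinearMap.mk₂ F (fun x y => extendMul L Sg.mul (hatMap S ρ x) (hatMap S (ρ ^ 2) y))
    (fun x x' y => by simp) (fun c x y => by
      rw [map_smul, ← algebraMap_smul L c (hatMap S ρ x), map_smul, LinearMap.smul_apply,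
        algebraMap_smul])
    (fun x y y' => by simp) (fun c x y => by
      rw [map_smul, ← algebraMap_smul L c (hatMap S (ρ ^ 2) y), map_smul, algebraMap_smul])

theorem inducedMul_apply (ρ : L ≃ₐ[F] L) (x y : L ⊗[F] S) :
    Sg.inducedMul ρ x y = extendMul L Sg.mul (hatMap S ρ x) (hatMap S (ρ ^ 2) y) := rfl

theorem hatMap_hatMap (ν ν' : L ≃ₐ[F] L) (x : L ⊗[F] S) :
    hatMap S ν (hatMap S ν' x) = hatMap S (ν * ν') x := by
  induction x using TensorProduct.induction_on with
  | zero => simp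
  | add u v hu hv => simp only [map_add, hu, hv]
  | tmul a s => simp

variable [Invertible (2 : F)]

theorem polar_extendMul_mul (x x' y z : L ⊗[F] S) :
    (Sg.n.baseChange L).polarBilin (extendMul L Sg.mul x y) (extendMul L Sg.mul x' z)
      + (Sg.n.baseChange L).polarBilin (extendMul L Sg.mul x' y) (extendMul L Sg.mul x z)
    = (Sg.n.baseChange L).polarBilin x x' * (Sg.n.baseChange L).polarBilin y z := by
  induction x using TensorProduct.induction_on with
  | zero => simp only [map_zero, LinearMap.zero_apply, zero_mul, add_zero]
  | add u v hu hv =>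
    simp only [map_add, LinearMap.add_apply, add_mul] at hu hv ⊢
    linear_combination hu + hv
  | tmul a s =>
  induction x' using TensorProduct.induction_on with
  | zero => simp only [map_zero, LinearMap.zero_apply, zero_mul, add_zero]
  | add u v hu hv =>
    simp only [map_add, LinearMap.add_apply, add_mul] at hu hv ⊢
    linear_combination hu + hv
  | tmul a' s' =>
  induction y using TensorProduct.induction_on with
  | zero => simp only [map_zero, LinearMap.zero_apply, mul_zero, add_zero]
  | add u v hu hv =>
    simp only [map_add, LinearMap.add_apply, mul_add] at hu hv ⊢
    linear_combination hu + hv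
  | tmul b t =>
  induction z using TensorProduct.induction_on with
  | zero => simp only [map_zero, mul_zero, add_zero]
  | add u v hu hv =>
    simp only [map_add, mul_add] at hu hv ⊢
    linear_combination hu + hv
  | tmul b' t' =>
  have h := congrArg (algebraMap F L) (Sg.polar_mul_mul s s' t t')
  simp only [map_add, map_mul] at h
  simp only [extendMul_tmul, polar_baseChange_tmul, Algebra.smul_def]
  linear_combination (a * a' * b * b') * h

theorem n_extendMul (x y : L ⊗[F] S) :
    Sg.n.baseChange L (extendMul L Sg.mul x y) = Sg.n.baseChange L x * Sg.n.baseChange L y := by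
  let : Invertible (2 : L) := (Invertible.map (algebraMap F L) 2).copy 2 (map_ofNat _ _).symm
  have h := Sg.polar_extendMul_mul x x y y
  simp only [polar_self] at h
  have h4 : (2 * 2 : L) * (⅟2 * ⅟2) = 1 := by
    rw [mul_mul_mul_comm]; simp
  linear_combination (⅟2 * ⅟2) * h - h4 *
    (Sg.n.baseChange L (extendMul L Sg.mul x y) - Sg.n.baseChange L x * Sg.n.baseChange L y)

theorem polar_extendMul (x y z : L ⊗[F] S) :
    (Sg.n.baseChange L).polarBilin (extendMul L Sg.mul x y) z
      = (Sg.n.baseChange L).polarBilin x (extendMul L Sg.mul y z) := by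
  induction x using TensorProduct.induction_on with
  | zero => simp only [map_zero, LinearMap.zero_apply]
  | add u v hu hv => simp only [map_add, LinearMap.add_apply, hu, hv]
  | tmul a s =>
  induction y using TensorProduct.induction_on with
  | zero => simp only [map_zero, LinearMap.zero_apply]
  | add u v hu hv => simp only [map_add, LinearMap.add_apply, hu, hv]
  | tmul b t =>
  induction z using TensorProduct.induction_on with
  | zero => simp only [map_zero]
  | add u v hu hv => simp only [map_add, hu, hv]
  | tmul c r =>
  simp only [extendMul_tmul, polar_baseChange_tmul, Sg.polar_mul, mul_assoc]

theorem n_hatMap (ν : L ≃ₐ[F] L) (x : L ⊗[F] S) :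
    Sg.n.baseChange L (hatMap S ν x) = ν (Sg.n.baseChange L x) := by
  let : Invertible (2 : L) := (Invertible.map (algebraMap F L) 2).copy 2 (map_ofNat _ _).symm
  have key : ∀ x y : L ⊗[F] S, (Sg.n.baseChange L).polarBilin (hatMap S ν x) (hatMap S ν y)
      = ν ((Sg.n.baseChange L).polarBilin x y) := by
    intro x y
    induction x using TensorProduct.induction_on with
    | zero => simp only [map_zero, LinearMap.zero_apply]
    | add u v hu hv => simp only [map_add, LinearMap.add_apply, hu, hv]
    | tmul a s =>
    induction y using TensorProduct.induction_on with
    | zero => simp only [map_zero]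
    | add u v hu hv => simp only [map_add, hu, hv]
    | tmul b t => simp only [hatMap_tmul, polar_baseChange_tmul, map_smul, map_mul]
  have h := key x x
  simp only [polar_self, map_mul, map_ofNat] at h
  have h2 : (2 : L) * ⅟2 = 1 := mul_invOf_self _
  linear_combination ⅟2 * h - h2 * (Sg.n.baseChange L (hatMap S ν x) - ν (Sg.n.baseChange L x))

theorem polar_hatMap (ν : L ≃ₐ[F] L) (x y : L ⊗[F] S) :
    (Sg.n.baseChange L).polarBilin (hatMap S ν x) (hatMap S ν y)
      = ν ((Sg.n.baseChange L).polarBilin x y) := by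
  simp only [QuadraticMap.polarBilin_apply_apply, QuadraticMap.polar, ← map_add, n_hatMap,
    ← map_sub]

theorem polar_inducedMul (A : CubicAlgebraWithAut F L) (x y z : L ⊗[F] S) :
    (Sg.n.baseChange L).polarBilin (Sg.inducedMul A.ρ x y) z
      = A.ρ ((Sg.n.baseChange L).polarBilin (Sg.inducedMul A.ρ y z) x) := by
  have h3 : A.ρ * A.ρ ^ 2 = 1 := by
    have h : A.ρ ^ 3 = 1 := by rw [← A.orderOf_ρ]; exact pow_orderOf_eq_one _
    rw [← h, pow_succ' _ 2]
  have h1 : hatMap S (1 : L ≃ₐ[F] L) z = z := by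
    induction z using TensorProduct.induction_on with
    | zero => simp
    | add u v hu hv => simp only [map_add, hu, hv]
    | tmul a s => simp
  rw [← polar_hatMap, inducedMul_apply, inducedMul_apply, hatMap_extendMul, hatMap_hatMap,
    hatMap_hatMap, h3, h1, ← pow_two, polar_extendMul]
  simp only [QuadraticMap.polarBilin_apply_apply]
  rw [QuadraticMap.polar_comm]

/-- The cyclic composition `Σ ⊗ (L, ρ)`. -/
noncomputable def tensor (A : CubicAlgebraWithAut F L) : CyclicComposition F L (L ⊗[F] S) where
  toCubicAlgebraWithAut := A
  free := inferInstance
  finrank_module := by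
    have : Nontrivial L := by
      refine Module.nontrivial_of_finrank_pos (R := F) ?_
      rw [A.finrank_eq]; norm_num
    rw [Module.finrank_baseChange, Sg.finrank_eq]
  Q := Sg.n.baseChange L
  nondegenerate := nondegenerate_baseChange _
    (Module.finite_of_finrank_pos (by rw [Sg.finrank_eq]; norm_num)) Sg.nondegenerate
  mul := Sg.inducedMul A.ρ
  smul_mul l x y := by
    rw [inducedMul_apply, hatMap_smul, map_smul, LinearMap.smul_apply, inducedMul_apply]
  mul_smul l x y := by
    rw [inducedMul_apply, hatMap_smul, map_smul, inducedMul_apply]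
  Q_mul x y := by
    rw [inducedMul_apply, n_extendMul, n_hatMap, n_hatMap]
  polar_mul := Sg.polar_inducedMul A
  polar_mul' x y z := by
    rw [Sg.polar_inducedMul A, Sg.polar_inducedMul A]
    simp [pow_two]

end SymmetricComposition

/-- A cyclic composition is induced if it is isotopic to `Σ ⊗ (L, ρ)` for some symmetric
composition `Σ`. (Such a `Σ` can always be found on an `F`-subspace of `V`, whence the choice of
universe.) -/
def CyclicComposition.IsInduced {F : Type u} {L : Type v} {V : Type w} [Field F]
    [Invertible (2 : F)] [CommRing L] [Algebra F L] [AddCommGroup V] [Module F V] [Module L V] [IsScalarTower F L V]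
    (Γ : CyclicComposition F L V) : Prop :=
  ∃ (S : Type w) (_ : AddCommGroup S) (_ : Module F S) (Sg : SymmetricComposition F S)
    (ν : L ≃ₐ[F] L) (f : L ⊗[F] S ≃ₗ[F] V), (Sg.tensor Γ.toCubicAlgebraWithAut).IsIsotopy Γ ν f

/-- The twisted module `ᵛV`, whose elements `ᵛx` correspond to the `x ∈ V`, with the scalar
multiplication determined by `ν(l) • ᵛx = ᵛ(l • x)`. -/
def Twist {F L : Type*} [Field F] [CommRing L] [Algebra F L] (_ν : L ≃ₐ[F] L) (V : Type*) := V

namespace Twist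

variable {F L V : Type*} [Field F] [CommRing L] [Algebra F L] [AddCommGroup V] [Module L V]

instance (ν : L ≃ₐ[F] L) : AddCommGroup (Twist ν V) := inferInstanceAs (AddCommGroup V)

instance (ν : L ≃ₐ[F] L) : Module L (Twist ν V) :=
  Module.compHom V (ν.symm : L →+* L)

/-- The additive bijection `x ↦ ᵛx`. -/
def mk (ν : L ≃ₐ[F] L) : V ≃+ Twist ν V := AddEquiv.refl V

theorem smul_mk (ν : L ≃ₐ[F] L) (l : L) (x : V) : l • mk ν x = mk ν (ν.symm l • x) := rfl

theorem mk_symm_smul (ν : L ≃ₐ[F] L) (l : L) (x : Twist ν V) :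
    (mk ν).symm (l • x) = ν.symm l • (mk ν).symm x := rfl

/-- The ring isomorphism `g ↦ ᵛg` from `End_L V` to `End_L (ᵛV)`, where `ᵛg (ᵛx) = ᵛ(g x)`; it
identifies `End_L (ᵛV)` with the twisted algebra `ᵛ(End_L V)`. -/
def mkEnd (ν : L ≃ₐ[F] L) : Module.End L V ≃+* Module.End L (Twist ν V) where
  toFun g :=
    { toFun := fun x => mk ν (g ((mk ν).symm x))
      map_add' := fun x y => by simp
      map_smul' := fun l x => by
        simp [mk_symm_smul, smul_mk] }
  invFun h :=
    { toFun := fun x => (mk ν).symm (h (mk ν x))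
      map_add' := fun x y => by simp
      map_smul' := fun l x => by
        have : mk ν (l • x) = ν l • mk ν x := by simp [smul_mk]
        simp [this, mk_symm_smul] }
  left_inv g := LinearMap.ext fun _ => rfl
  right_inv h := LinearMap.ext fun _ => rfl
  map_mul' g h := LinearMap.ext fun _ => rfl
  map_add' g h := LinearMap.ext fun _ => rfl

theorem mkEnd_apply (ν : L ≃ₐ[F] L) (g : Module.End L V) (x : V) :
    mkEnd ν g (mk ν x) = mk ν (g x) := rfl

end Twist

namespace CyclicComposition

section AlphaStar

variable {F L V : Type*} [Field F] [CommRing L] [Algebra F L] [AddCommGroup V] [Module F V]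
  [Module L V] [IsScalarTower F L V] (Γ : CyclicComposition F L V)

theorem polar_mul_left (x y z : V) : Γ.Q.polarBilin (Γ.mul x y) (Γ.mul x z)
    = Γ.ρ (Γ.Q x) * (Γ.ρ ^ 2) (Γ.Q.polarBilin y z) := by
  simp only [QuadraticMap.polarBilin_apply_apply, QuadraticMap.polar, ← map_add, Γ.Q_mul, map_sub]
  ring

theorem polar_mul_right (x y z : V) : Γ.Q.polarBilin (Γ.mul y x) (Γ.mul z x)
    = Γ.ρ (Γ.Q.polarBilin y z) * (Γ.ρ ^ 2) (Γ.Q x) := by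
  simp only [QuadraticMap.polarBilin_apply_apply, QuadraticMap.polar, ← map_add,
    ← LinearMap.add_apply, Γ.Q_mul, map_sub]
  ring

theorem polar_comm (x y : V) : Γ.Q.polarBilin x y = Γ.Q.polarBilin y x := by
  simp only [QuadraticMap.polarBilin_apply_apply]
  rw [QuadraticMap.polar_comm]

theorem eq_of_polar {x y : V} (h : ∀ z, Γ.Q.polarBilin x z = Γ.Q.polarBilin y z) : x = y := by
  rw [← sub_eq_zero]
  refine Γ.nondegenerate.1 _ fun z => ?_
  rw [map_sub, LinearMap.sub_apply, h, sub_self]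

theorem mul_mul_self (x y : V) : Γ.mul (Γ.mul x y) x = (Γ.ρ ^ 2) (Γ.Q x) • y := by
  refine Γ.eq_of_polar fun z => ?_
  rw [Γ.polar_mul, Γ.polar_mul_left, Γ.polar_comm z y]
  have := Γ.ρ_ρ_ρ (Γ.Q.polarBilin y z)
  simp [pow_two] at this ⊢
  rw [this]

theorem self_mul_mul (x y : V) : Γ.mul x (Γ.mul y x) = Γ.ρ (Γ.Q x) • y := by
  refine Γ.eq_of_polar fun z => ?_
  rw [Γ.polar_mul', Γ.polar_mul_right, Γ.polar_comm z y]
  have := Γ.ρ_ρ_ρ (Γ.Q.polarBilin y z)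
  have h2 := Γ.ρ_ρ_ρ (Γ.Q x)
  simp [pow_two] at this h2 ⊢
  rw [this, h2, mul_comm]

/-- The `L`-linear map `ℓ_x : ᵖV → ᶿV`, `ℓ_x(ᵖy) = ᶿ(x * y)`. -/
def ell (x : V) : Twist Γ.ρ V →ₗ[L] Twist Γ.θ V where
  toFun y := Twist.mk Γ.θ (Γ.mul x ((Twist.mk Γ.ρ).symm y))
  map_add' y y' := by simp
  map_smul' l y := by
    simp only [Twist.mk_symm_smul, Γ.mul_smul, Twist.smul_mk, RingHom.id_apply,
      CubicAlgebraWithAut.ρ_symm_apply, CubicAlgebraWithAut.θ_symm_apply, pow_two,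
      AlgEquiv.mul_apply, CubicAlgebraWithAut.ρ_ρ_ρ]

/-- The `L`-linear map `r_x : ᶿV → ᵖV`, `r_x(ᶿz) = ᵖ(z * x)`. -/
def r (x : V) : Twist Γ.θ V →ₗ[L] Twist Γ.ρ V where
  toFun z := Twist.mk Γ.ρ (Γ.mul ((Twist.mk Γ.θ).symm z) x)
  map_add' y y' := by simp
  map_smul' l y := by
    simp only [Twist.mk_symm_smul, Γ.smul_mul, Twist.smul_mk, RingHom.id_apply,
      CubicAlgebraWithAut.ρ_symm_apply, CubicAlgebraWithAut.θ_symm_apply]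

theorem ell_apply (x y : V) : Γ.ell x (Twist.mk Γ.ρ y) = Twist.mk Γ.θ (Γ.mul x y) := rfl

theorem r_apply (x z : V) : Γ.r x (Twist.mk Γ.θ z) = Twist.mk Γ.ρ (Γ.mul z x) := rfl

theorem ell_add (x x' : V) : Γ.ell (x + x') = Γ.ell x + Γ.ell x' := by
  ext y
  obtain ⟨y, rfl⟩ := (Twist.mk Γ.ρ).surjective y
  simp [ell_apply]

theorem ell_smul (l : L) (x : V) : Γ.ell (l • x) = l • Γ.ell x := by
  ext y
  obtain ⟨y, rfl⟩ := (Twist.mk Γ.ρ).surjective y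
  simp only [LinearMap.smul_apply, ell_apply, Twist.smul_mk, Γ.smul_mul,
    CubicAlgebraWithAut.θ_symm_apply]

theorem r_add (x x' : V) : Γ.r (x + x') = Γ.r x + Γ.r x' := by
  ext y
  obtain ⟨y, rfl⟩ := (Twist.mk Γ.θ).surjective y
  simp [r_apply]

theorem r_smul (l : L) (x : V) : Γ.r (l • x) = l • Γ.r x := by
  ext y
  obtain ⟨y, rfl⟩ := (Twist.mk Γ.θ).surjective y
  simp only [LinearMap.smul_apply, r_apply, Twist.smul_mk, Γ.mul_smul,
    CubicAlgebraWithAut.ρ_symm_apply, pow_two, AlgEquiv.mul_apply]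

theorem r_comp_ell (x : V) : Γ.r x ∘ₗ Γ.ell x = Γ.Q x • LinearMap.id := by
  ext y
  obtain ⟨y, rfl⟩ := (Twist.mk Γ.ρ).surjective y
  simp only [LinearMap.comp_apply, ell_apply, r_apply, mul_mul_self, LinearMap.smul_apply,
    LinearMap.id_apply, Twist.smul_mk, CubicAlgebraWithAut.ρ_symm_apply, pow_two,
    AlgEquiv.mul_apply]

theorem ell_comp_r (x : V) : Γ.ell x ∘ₗ Γ.r x = Γ.Q x • LinearMap.id := by
  ext y
  obtain ⟨y, rfl⟩ := (Twist.mk Γ.θ).surjective y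
  simp only [LinearMap.comp_apply, ell_apply, r_apply, self_mul_mul, LinearMap.smul_apply,
    LinearMap.id_apply, Twist.smul_mk, CubicAlgebraWithAut.θ_symm_apply]

/-- The linear map `V → End_L (ᵖV ⊕ ᶿV)`, `x ↦ ((ᵖy, ᶿz) ↦ (r_x(ᶿz), ℓ_x(ᵖy)))`. -/
def alphaStarι : V →ₗ[L] Module.End L (Twist Γ.ρ V × Twist Γ.θ V) where
  toFun x := LinearMap.prod (Γ.r x ∘ₗ LinearMap.snd L _ _) (Γ.ell x ∘ₗ LinearMap.fst L _ _)
  map_add' x x' := by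
    apply LinearMap.ext; intro y
    simp [r_add, ell_add]
  map_smul' l x := by
    apply LinearMap.ext; intro y
    simp [r_smul, ell_smul]

theorem alphaStarι_apply (x : V) (y : Twist Γ.ρ V) (z : Twist Γ.θ V) :
    Γ.alphaStarι x (y, z) = (Γ.r x z, Γ.ell x y) := rfl

theorem alphaStarι_mul_self (x : V) :
    Γ.alphaStarι x * Γ.alphaStarι x = algebraMap L _ (Γ.Q x) := by
  apply LinearMap.ext
  rintro ⟨y, z⟩
  have h1 := LinearMap.congr_fun (Γ.r_comp_ell x) y
  have h2 := LinearMap.congr_fun (Γ.ell_comp_r x) z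
  simp only [LinearMap.comp_apply, LinearMap.smul_apply, LinearMap.id_apply] at h1 h2
  simp [Module.End.mul_apply, alphaStarι_apply, h1, h2, Module.algebraMap_end_apply]

/-- The homomorphism `α_* : C(V, Q) → End_L (ᵖV ⊕ ᶿV)`. -/
noncomputable def alphaStar :
    CliffordAlgebra Γ.Q →ₐ[L] Module.End L (Twist Γ.ρ V × Twist Γ.θ V) :=
  CliffordAlgebra.lift Γ.Q ⟨Γ.alphaStarι, Γ.alphaStarι_mul_self⟩

/-- The homomorphism `α_{*0} : C₀(V, Q) → End_L (ᵖV) × End_L (ᶿV)`, given on products of two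
vectors by `x · y ↦ (r_x ℓ_y, ℓ_x r_y)`. -/
noncomputable def alphaStarZero :
    CliffordAlgebra.even Γ.Q →ₐ[L] Module.End L (Twist Γ.ρ V) × Module.End L (Twist Γ.θ V) :=
  CliffordAlgebra.even.lift Γ.Q
    { bilin := LinearMap.mk₂ L (fun x y => (Γ.r x ∘ₗ Γ.ell y, Γ.ell x ∘ₗ Γ.r y))
        (fun x x' y => by simp [r_add, ell_add, LinearMap.add_comp])
        (fun l x y => by simp [r_smul, ell_smul, LinearMap.smul_comp])
        (fun x y y' => by simp [r_add, ell_add, LinearMap.comp_add])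
        (fun l x y => by simp [r_smul, ell_smul, LinearMap.comp_smul])
      contract := fun x => by
        rw [LinearMap.mk₂_apply, r_comp_ell, ell_comp_r]; rfl
      contract_mid := fun x y z => by
        have h1 := Γ.r_comp_ell y
        have h2 := Γ.ell_comp_r y
        refine Prod.ext ?_ ?_
        · change (Γ.r x ∘ₗ Γ.ell y) ∘ₗ (Γ.r y ∘ₗ Γ.ell z) = Γ.Q y • (Γ.r x ∘ₗ Γ.ell z)
          rw [LinearMap.comp_assoc, ← LinearMap.comp_assoc (Γ.ell z), h2, LinearMap.smul_comp,
            LinearMap.comp_smul, LinearMap.id_comp]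
        · change (Γ.ell x ∘ₗ Γ.r y) ∘ₗ (Γ.ell y ∘ₗ Γ.r z) = Γ.Q y • (Γ.ell x ∘ₗ Γ.r z)
          rw [LinearMap.comp_assoc, ← LinearMap.comp_assoc (Γ.r z), h1, LinearMap.smul_comp,
            LinearMap.comp_smul, LinearMap.id_comp] }

/-- `α_{*0}` is the restriction of `α_*` to the even Clifford algebra. -/
theorem alphaStar_coe_even (c : CliffordAlgebra.even Γ.Q) :
    Γ.alphaStar c = LinearMap.prodMap (Γ.alphaStarZero c).1 (Γ.alphaStarZero c).2 := by
  let P : Module.End L (Twist Γ.ρ V) × Module.End L (Twist Γ.θ V) →ₐ[L]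
      Module.End L (Twist Γ.ρ V × Twist Γ.θ V) := LinearMap.prodMapAlgHom L _ _
  have h : Γ.alphaStar.comp (CliffordAlgebra.even Γ.Q).val = P.comp Γ.alphaStarZero := by
    apply CliffordAlgebra.even.algHom_ext
    ext x y : 3
    change Γ.alphaStar (CliffordAlgebra.ι Γ.Q x * CliffordAlgebra.ι Γ.Q y)
      = P (Γ.alphaStarZero ((CliffordAlgebra.even.ι Γ.Q).bilin x y))
    rw [alphaStarZero, CliffordAlgebra.even.lift_ι, map_mul, alphaStar, CliffordAlgebra.lift_ι_apply,
      CliffordAlgebra.lift_ι_apply]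
    rfl
  exact DFunLike.congr_fun h c

end AlphaStar

section EndGamma

variable {F L V : Type*} [Field F] [Field L] [Algebra F L] [AddCommGroup V] [Module F V]
  [Module L V] [IsScalarTower F L V] (Γ : CyclicComposition F L V)

theorem finiteDimensional (Γ : CyclicComposition F L V) : FiniteDimensional L V :=
  FiniteDimensional.of_finrank_pos (by rw [Γ.finrank_module]; norm_num)

/-- The involution `σ_Q` of `End_L V` adjoint to `Q`. -/
noncomputable def sigma (g : Module.End L V) : Module.End L V :=
  haveI := Γ.finiteDimensional
  LinearMap.BilinForm.leftAdjointOfNondegenerate Γ.Q.polarBilin Γ.nondegenerate g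

theorem polar_sigma (g : Module.End L V) (x y : V) :
    Γ.Q.polarBilin (Γ.sigma g x) y = Γ.Q.polarBilin x (g y) :=
  haveI := Γ.finiteDimensional
  LinearMap.BilinForm.isAdjointPairLeftAdjointOfNondegenerate _ Γ.nondegenerate g x y

/-- The standard identification `V ⊗ V ≃ End_L V`, where `x ⊗ y` stands for
`z ↦ x · b_Q(y, z)`. -/
noncomputable def tensorEquivEnd : V ⊗[L] V ≃ₗ[L] Module.End L V :=
  haveI := Γ.finiteDimensional
  TensorProduct.comm L V V ≪≫ₗ
    TensorProduct.congr (LinearMap.BilinForm.toDual Γ.Q.polarBilin Γ.nondegenerate)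
      (LinearEquiv.refl L V) ≪≫ₗ dualTensorHomEquiv L V V

theorem tensorEquivEnd_tmul (x y z : V) :
    Γ.tensorEquivEnd (x ⊗ₜ[L] y) z = Γ.Q.polarBilin y z • x := by
  simp [tensorEquivEnd, LinearMap.BilinForm.toDual_def]

/-- The even Clifford algebra `C₀(V, Q)` serves as the Clifford algebra `C(End_L V, σ_Q)` of the
algebra with involution `(End_L V, σ_Q)`; this is the canonical linear map
`End_L V → C(End_L V, σ_Q)`, mapping `x ⊗ y` to `x · y`. -/
noncomputable def cliffordMap : Module.End L V →ₗ[L] CliffordAlgebra.even Γ.Q :=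
  TensorProduct.lift (CliffordAlgebra.even.ι Γ.Q).bilin ∘ₗ Γ.tensorEquivEnd.symm.toLinearMap

theorem cliffordMap_tensor (x y : V) :
    (Γ.cliffordMap (Γ.tensorEquivEnd (x ⊗ₜ[L] y)) : CliffordAlgebra Γ.Q)
      = CliffordAlgebra.ι Γ.Q x * CliffordAlgebra.ι Γ.Q y := by
  simp only [cliffordMap, LinearMap.comp_apply, LinearEquiv.coe_coe, LinearEquiv.symm_apply_apply,
    TensorProduct.lift.tmul]
  rfl

variable {L' V' : Type*} [Field L'] [Algebra F L'] [AddCommGroup V'] [Module F V']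
  [Module L' V'] [IsScalarTower F L' V'] (Γ' : CyclicComposition F L' V')
  {L'' V'' : Type*} [Field L''] [Algebra F L''] [AddCommGroup V''] [Module F V'']
  [Module L'' V''] [IsScalarTower F L'' V''] (Γ'' : CyclicComposition F L'' V'')

/-- `Φ` is the isomorphism `C(φ) : C(End_L V, σ_Q) → C(End_L' V', σ_Q')` induced by functoriality
by `φ`, an isomorphism of algebras with involution that restricts to `ν : L → L'`. It is the only
`ν`-semilinear ring isomorphism that is compatible with `φ` under the canonical maps. -/
structure IsCliffordInduced (ν : L ≃ₐ[F] L') (φ : Module.End L V ≃ₐ[F] Module.End L' V')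
    (Φ : CliffordAlgebra.even Γ.Q ≃+* CliffordAlgebra.even Γ'.Q) : Prop where
  semilinear : ∀ (l : L) (c : CliffordAlgebra.even Γ.Q), Φ (l • c) = ν l • Φ c
  map_cliffordMap : ∀ g : Module.End L V, Φ (Γ.cliffordMap g) = Γ'.cliffordMap (φ g)

theorem IsCliffordInduced.unique {ν : L ≃ₐ[F] L'} {φ : Module.End L V ≃ₐ[F] Module.End L' V'}
    {Φ Ψ : CliffordAlgebra.even Γ.Q ≃+* CliffordAlgebra.even Γ'.Q}
    (hΦ : Γ.IsCliffordInduced Γ' ν φ Φ) (hΨ : Γ.IsCliffordInduced Γ' ν φ Ψ) : Φ = Ψ := by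
  let κ : CliffordAlgebra.even Γ.Q →ₐ[L] CliffordAlgebra.even Γ.Q :=
    AlgHom.ofLinearMap
      { toFun := fun c => Ψ.symm (Φ c)
        map_add' := fun c d => by simp
        map_smul' := fun l c => by
          rw [RingEquiv.symm_apply_eq]
          simp [hΦ.semilinear, hΨ.semilinear] }
      (by simp) (fun c d => by simp)
  have h : κ = AlgHom.id L _ := by
    apply CliffordAlgebra.even.algHom_ext
    ext x y : 3
    change Ψ.symm (Φ ((CliffordAlgebra.even.ι Γ.Q).bilin x y))
      = (CliffordAlgebra.even.ι Γ.Q).bilin x y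
    have hxy : (CliffordAlgebra.even.ι Γ.Q).bilin x y
        = Γ.cliffordMap (Γ.tensorEquivEnd (x ⊗ₜ[L] y)) := by simp [cliffordMap]
    rw [RingEquiv.symm_apply_eq, hxy, hΦ.map_cliffordMap, hΨ.map_cliffordMap]
  ext c : 1
  have := DFunLike.congr_fun h c
  change Ψ.symm (Φ c) = c at this
  rwa [RingEquiv.symm_apply_eq] at this

/-- Isomorphisms of trialitarian algebras `End Γ → End Γ'`, where
`End Γ = (End_L V, L, σ_Q, α_{*0})`: the isomorphisms of `F`-algebras with involution
`φ : (End_L V, σ_Q) → (End_L' V', σ_Q')` that restrict to an isomorphism `(L, ρ) → (L', ρ')` of the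
centers and satisfy `(ᵖφ × ᶿφ) ∘ α_{*0} = α_{*'0} ∘ C(φ)`. -/
def IsTrialitarianIso (φ : Module.End L V ≃ₐ[F] Module.End L' V') : Prop :=
  (∀ g, φ (Γ.sigma g) = Γ'.sigma (φ g)) ∧
  ∃ ν : L ≃ₐ[F] L', (∀ l, ν (Γ.ρ l) = Γ'.ρ (ν l)) ∧
    (∀ l, φ (algebraMap L (Module.End L V) l) = algebraMap L' (Module.End L' V') (ν l)) ∧
    ∃ Φ : CliffordAlgebra.even Γ.Q ≃+* CliffordAlgebra.even Γ'.Q,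
      Γ.IsCliffordInduced Γ' ν φ Φ ∧
      ∀ c : CliffordAlgebra.even Γ.Q,
        Γ'.alphaStarZero (Φ c) =
          (Twist.mkEnd Γ'.ρ (φ ((Twist.mkEnd Γ.ρ).symm (Γ.alphaStarZero c).1)),
            Twist.mkEnd Γ'.θ (φ ((Twist.mkEnd Γ.θ).symm (Γ.alphaStarZero c).2)))

theorem isTrialitarianIso_refl : Γ.IsTrialitarianIso Γ AlgEquiv.refl :=
  ⟨fun _ => rfl, AlgEquiv.refl, fun _ => rfl, fun _ => rfl, RingEquiv.refl _,
    ⟨fun _ _ => rfl, fun _ => rfl⟩, fun c => by simp⟩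

variable {Γ Γ' Γ''} in
theorem IsTrialitarianIso.symm {φ : Module.End L V ≃ₐ[F] Module.End L' V'}
    (h : Γ.IsTrialitarianIso Γ' φ) : Γ'.IsTrialitarianIso Γ φ.symm := by
  obtain ⟨h1, ν, h2, h3, Φ, h4, h5⟩ := h
  refine ⟨fun g => ?_, ν.symm, fun l => ?_, fun l => ?_, Φ.symm, ⟨fun l c => ?_, fun g => ?_⟩,
    fun c => ?_⟩
  · rw [AlgEquiv.symm_apply_eq, h1, AlgEquiv.apply_symm_apply]
  · rw [AlgEquiv.symm_apply_eq, h2, AlgEquiv.apply_symm_apply]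
  · rw [AlgEquiv.symm_apply_eq, h3, AlgEquiv.apply_symm_apply]
  · rw [RingEquiv.symm_apply_eq, h4.semilinear, AlgEquiv.apply_symm_apply,
      RingEquiv.apply_symm_apply]
  · rw [RingEquiv.symm_apply_eq, h4.map_cliffordMap, AlgEquiv.apply_symm_apply]
  · obtain ⟨c, rfl⟩ := Φ.surjective c
    simp [h5]

variable {Γ Γ' Γ''} in
theorem IsTrialitarianIso.trans {φ : Module.End L V ≃ₐ[F] Module.End L' V'}
    {ψ : Module.End L' V' ≃ₐ[F] Module.End L'' V''}
    (h : Γ.IsTrialitarianIso Γ' φ) (k : Γ'.IsTrialitarianIso Γ'' ψ) :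
    Γ.IsTrialitarianIso Γ'' (φ.trans ψ) := by
  obtain ⟨h1, ν, h2, h3, Φ, h4, h5⟩ := h
  obtain ⟨k1, ν', k2, k3, Φ', k4, k5⟩ := k
  refine ⟨fun g => ?_, ν.trans ν', fun l => ?_, fun l => ?_, Φ.trans Φ',
    ⟨fun l c => ?_, fun g => ?_⟩, fun c => ?_⟩
  · simp [h1, k1]
  · simp [h2, k2]
  · rw [AlgEquiv.trans_apply, h3, k3, AlgEquiv.trans_apply]
  · simp [h4.semilinear, k4.semilinear]
  · simp [h4.map_cliffordMap, k4.map_cliffordMap]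
  · simp [h5, k5]

/-- The group `Aut_F (End Γ)` of `F`-automorphisms of the trialitarian algebra `End Γ`. -/
def autEnd : Subgroup (Module.End L V ≃ₐ[F] Module.End L V) where
  carrier := {φ | Γ.IsTrialitarianIso Γ φ}
  one_mem' := Γ.isTrialitarianIso_refl
  mul_mem' h k := k.trans h
  inv_mem' h := h.symm

end EndGamma

end CyclicComposition

/-- For a `ν`-semilinear bijection `t : V → V`, the automorphism `Int(t)|_{End_L V}`,
`g ↦ t ∘ g ∘ t⁻¹`, of `End_L V`. -/
def semilinearInt {F L V : Type*} [Field F] [CommRing L] [Algebra F L] [AddCommGroup V]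
    [Module F V] [Module L V] [IsScalarTower F L V] (ν : L ≃ₐ[F] L) (t : V ≃ₗ[F] V)
    (ht : ∀ (l : L) (x : V), t (l • x) = ν l • t x) :
    Module.End L V ≃ₐ[F] Module.End L V :=
  have ht' : ∀ (l : L) (x : V), t.symm (l • x) = ν.symm l • t.symm x := fun l x => by
    rw [LinearEquiv.symm_apply_eq, ht, AlgEquiv.apply_symm_apply, LinearEquiv.apply_symm_apply]
  { toFun := fun g =>
      { toFun := fun x => t (g (t.symm x))
        map_add' := fun x y => by simp
        map_smul' := fun l x => by simp [ht, ht'] }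
    invFun := fun g =>
      { toFun := fun x => t.symm (g (t x))
        map_add' := fun x y => by simp
        map_smul' := fun l x => by simp [ht, ht'] }
    left_inv := fun g => by ext x; simp
    right_inv := fun g => by ext x; simp
    map_mul' := fun g h => by ext x; simp
    map_add' := fun g h => by ext x; simp
    commutes' := fun c => by ext x; simp [Module.algebraMap_end_apply] }

section Tau

variable {F L V S : Type*} [Field F] [Invertible (2 : F)] [Field L] [Algebra F L]
  [AddCommGroup V] [Module F V] [Module L V] [IsScalarTower F L V] [AddCommGroup S] [Module F S]
  {Γ : CyclicComposition F L V} {Sg : SymmetricComposition F S}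

/-- The map `f ∘ ρ̂ ∘ f⁻¹ : V → V` for `f : L ⊗ S → V`, where `ρ̂ = ρ ⊗ Id`. -/
noncomputable def conjHat (ρ : L ≃ₐ[F] L) (f : L ⊗[F] S ≃ₗ[F] V) : V ≃ₗ[F] V :=
  (f.symm.trans (hatMap S ρ)).trans f

theorem conjHat_smul {f : L ⊗[F] S ≃ₗ[F] V}
    (hf : (Sg.tensor Γ.toCubicAlgebraWithAut).IsLinearIsotopy Γ f) (l : L) (x : V) :
    conjHat Γ.ρ f (l • x) = Γ.ρ l • conjHat Γ.ρ f x := by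
  have h : ∀ (l : L) (y : L ⊗[F] S), f (l • y) = l • f y := hf.semilinear
  obtain ⟨y, rfl⟩ := f.surjective x
  change f (hatMap S Γ.ρ (f.symm (l • f y))) = Γ.ρ l • f (hatMap S Γ.ρ (f.symm (f y)))
  rw [← h, f.symm_apply_apply, f.symm_apply_apply, hatMap_smul, h]

/-- `τ_{(Σ,f)} = Int(f ∘ ρ̂ ∘ f⁻¹)|_{End_L V}` for an `L`-linear isotopy `f : Σ ⊗ (L, ρ) → Γ`. -/
noncomputable def tau {f : L ⊗[F] S ≃ₗ[F] V}
    (hf : (Sg.tensor Γ.toCubicAlgebraWithAut).IsLinearIsotopy Γ f) :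
    Module.End L V ≃ₐ[F] Module.End L V :=
  semilinearInt Γ.ρ (conjHat Γ.ρ f) (conjHat_smul hf)

theorem tau_apply {f : L ⊗[F] S ≃ₗ[F] V}
    (hf : (Sg.tensor Γ.toCubicAlgebraWithAut).IsLinearIsotopy Γ f) (g : Module.End L V) (x : V) :
    tau hf g x = f (hatMap S Γ.ρ (f.symm (g (f ((hatMap S Γ.ρ).symm (f.symm x)))))) := rfl

end Tau

/-! Both directions rest on the correspondence between semilinear auto-isotopies t of Γ and the
automorphisms Int(t) of End Γ.

For (i), the map ρ ⊗ Id is an isotopy of Σ ⊗ (L, ρ) with multiplier 1 and has cube 1. Transported by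
f it is a ρ-semilinear isotopy t of Γ, and conjugation by any isotopy respects σ_Q and α_{*0}; the
latter is an identity between triple products, checked on the generators x · y of C₀(V, Q)
(`semilinearInt_mem_autEnd`). An isomorphism e from Σ to Σ' gives the isotopy f' (Id ⊗ e) f⁻¹ of Γ,
which conjugates one τ into the other.

For (ii), Skolem-Noether gives τ = Int(t) with t ρ-semilinear (`exists_eq_semilinearInt`). Commuting
with σ_Q makes t a similitude, Q(t x) = ρ(c Q(x)), and compatibility with α_{*0} controls t only on
triple products. To reach the product itself, let u be the linear map with t(u(y * z)) = t(y) *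
t(z). The triple product identities show that u commutes with every z ↦ (y * z) * x. These maps
contain the images of six anticommuting units of C₀(V, Q), whose centralizer in the 64-dimensional
algebra End_L V is L, so u is a scalar and t(x) * t(y) = μ t(x * y) (`exists_mul_eq_smul`). Then
ρ(c) = ρ(μ) ρ²(μ), and τ³ = Id forces t³ = μ ρ(μ) ρ²(μ) (`multiplier_eq`, `apply_apply_apply_eq`).

Hence s = μ⁻¹ t satisfies s³ = Id and Int(s) = τ. By Galois descent V = L ⊗ S, where S is the space
of fixed vectors of s. With η = ρ²(μ) / μ, the form η⁻¹ Q and the product η (x * y) restrict to S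
and make it a symmetric composition (`exists_symmetricComposition`). -/

/-! ### Trace and dual bases of the cyclic cubic extension L of F. -/

namespace CubicAlgebraWithAut

variable {F L : Type*} [Field F] [Field L] [Algebra F L] (A : CubicAlgebraWithAut F L)

include A in
theorem finiteDimensional : FiniteDimensional F L :=
  FiniteDimensional.of_finrank_pos (by rw [A.finrank_eq]; norm_num)

/-- By Artin, L has degree 3 over the fixed field of ⟨ρ⟩. This is also its degree over F, so the
fixed field is F. -/
theorem eq_algebraMap_of_ρ_eq {x : L} (hx : A.ρ x = x) : ∃ c : F, algebraMap F L c = x := by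
  have := A.finiteDimensional
  have h := IntermediateField.finrank_fixedField_eq_card (F := F) (E := L)
    (Subgroup.zpowers A.ρ)
  rw [Nat.card_zpowers, A.orderOf_ρ] at h
  have h1 := Module.finrank_mul_finrank F (IntermediateField.fixedField (Subgroup.zpowers A.ρ)) L
  rw [h, A.finrank_eq] at h1
  have h2 : IntermediateField.fixedField (Subgroup.zpowers A.ρ) = ⊥ :=
    IntermediateField.finrank_eq_one_iff.1 (by omega)
  have h3 : x ∈ IntermediateField.fixedField (Subgroup.zpowers A.ρ) := by
    rw [IntermediateField.mem_fixedField_iff]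
    rintro g ⟨n, rfl⟩
    have : A.ρ ∈ MulAction.stabilizer (L ≃ₐ[F] L) x := hx
    exact Subgroup.zpow_mem _ this n
  rw [h2] at h3
  exact IntermediateField.mem_bot.1 h3

theorem exists_trace (x : L) : ∃ c : F, algebraMap F L c = x + A.ρ x + A.ρ (A.ρ x) :=
  A.eq_algebraMap_of_ρ_eq (by simp only [map_add, A.ρ_ρ_ρ]; ring)

/-- The sum `x + ρ(x) + ρ²(x)` as an element of `F`. -/
noncomputable def tr (x : L) : F := (A.exists_trace x).choose

theorem algebraMap_tr (x : L) : algebraMap F L (A.tr x) = x + A.ρ x + A.ρ (A.ρ x) :=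
  (A.exists_trace x).choose_spec

/-- Dedekind: the characters 1, ρ, ρ² are distinct because ρ has order 3, hence linearly independent
over L. -/
theorem eq_zero_of_sum_ρ_eq_zero {c : Fin 3 → L}
    (h : ∀ l : L, c 0 * l + c 1 * A.ρ l + c 2 * A.ρ (A.ρ l) = 0) : c = 0 := by
  have hinj : Function.Injective
      (fun i : Fin 3 => ((A.ρ ^ (i : ℕ) : L ≃ₐ[F] L) : L →* L)) := by
    intro i j hij
    have h1 : A.ρ ^ (i : ℕ) = A.ρ ^ (j : ℕ) := by
      ext l
      exact DFunLike.congr_fun hij l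
    exact Fin.ext (pow_injOn_Iio_orderOf (by simp [A.orderOf_ρ]) (by simp [A.orderOf_ρ]) h1)
  have hli := (linearIndependent_monoidHom L L).comp _ hinj
  rw [Fintype.linearIndependent_iff] at hli
  funext i
  refine hli c ?_ i
  funext l
  have := h l
  simpa [Fin.sum_univ_three, pow_two] using this

/-- Dual families in `L`, i.e. `F`-bases of `L` in duality for the trace form. -/
theorem exists_dual_bases : ∃ b b' : Fin 3 → L,
    (∀ l : L, ∑ j, A.tr (b j * l) • b' j = l) ∧ ∑ j, b' j * b j = 1 ∧
      ∑ j, b' j * A.ρ (b j) = 0 ∧ ∑ j, b' j * A.ρ (A.ρ (b j)) = 0 := by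
  have := A.finiteDimensional
  let B : LinearMap.BilinForm F L := LinearMap.mk₂ F (fun x y => A.tr (x * y))
    (fun x x' y => (algebraMap F L).injective (by
      simp only [map_add, algebraMap_tr, add_mul]; ring))
    (fun c x y => (algebraMap F L).injective (by
      simp only [algebraMap_tr, Algebra.smul_def, map_mul, AlgEquiv.commutes,
        Algebra.algebraMap_self, RingHom.id_apply]; ring))
    (fun x x' y => (algebraMap F L).injective (by
      simp only [map_add, algebraMap_tr, mul_add]; ring))
    (fun c x y => (algebraMap F L).injective (by
      simp only [algebraMap_tr, Algebra.smul_def, map_mul, AlgEquiv.commutes,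
        Algebra.algebraMap_self, RingHom.id_apply]; ring))
  -- Expanding the trace turns tr(x l) = 0 for all l into a relation between 1, ρ, ρ² with
  -- coefficients x, ρ(x), ρ²(x).
  have hl : ∀ x, (∀ y, B x y = 0) → x = 0 := by
    intro x hx
    have := A.eq_zero_of_sum_ρ_eq_zero (c := ![x, A.ρ x, A.ρ (A.ρ x)]) fun l => by
      have := congrArg (algebraMap F L) (hx l)
      simpa [B, algebraMap_tr] using this
    simpa using congrFun this 0
  have hsymm : ∀ x y, B x y = B y x := fun x y => by simp [B, mul_comm]
  have hB : B.Nondegenerate := ⟨hl, fun y hy => hl y fun x => by rw [hsymm]; exact hy x⟩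
  let b : Module.Basis (Fin 3) F L := Module.finBasisOfFinrankEq F L A.finrank_eq
  let b' := LinearMap.BilinForm.dualBasis B hB b
  have h1 : ∀ l : L, ∑ j, A.tr (b j * l) • b' j = l := by
    intro l
    conv_rhs => rw [← b'.sum_repr l]
    refine Finset.sum_congr rfl fun j _ => ?_
    congr 1
    change B (b j) l = _
    conv_lhs => rw [← b'.sum_repr l]
    simp [map_sum, hsymm (b j), b', LinearMap.BilinForm.apply_dualBasis_left]
  refine ⟨b, b', h1, ?_⟩
  -- Expanding the trace in `h1` writes the identity of L as a combination of 1, ρ, ρ², so the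
  -- coefficients must be 1, 0, 0.
  have h2 := A.eq_zero_of_sum_ρ_eq_zero
    (c := ![∑ j, b' j * b j - 1, ∑ j, b' j * A.ρ (b j), ∑ j, b' j * A.ρ (A.ρ (b j))]) fun l => by
      have h3 : ∑ j, (b' j * b j * l + b' j * A.ρ (b j) * A.ρ l
          + b' j * A.ρ (A.ρ (b j)) * A.ρ (A.ρ l)) = l := by
        conv_rhs => rw [← h1 l]
        refine Finset.sum_congr rfl fun j _ => ?_
        simp only [Algebra.smul_def, algebraMap_tr, map_mul]
        ring
      simp only [Finset.sum_add_distrib, ← Finset.sum_mul] at h3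
      simp only [Matrix.cons_val_zero, Matrix.cons_val_one, Matrix.cons_val]
      linear_combination h3
  refine ⟨?_, ?_, ?_⟩
  · simpa [sub_eq_zero] using congrFun h2 0
  · simpa using congrFun h2 1
  · simpa using congrFun h2 2

end CubicAlgebraWithAut

/-! ### Galois descent along L/F. -/

section Descent

variable {F L V : Type*} [Field F] [Field L] [Algebra F L] [AddCommGroup V] [Module F V]
  [Module L V] [IsScalarTower F L V]

/-- The `F`-subspace of the fixed vectors of `t`. -/
def fixedSubmodule (t : V ≃ₗ[F] V) : Submodule F V where
  carrier := {x | t x = x}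
  add_mem' {x y} hx hy := by
    change t (x + y) = x + y
    rw [map_add, show t x = x from hx, show t y = y from hy]
  zero_mem' := map_zero t
  smul_mem' c x hx := by
    change t (c • x) = c • x
    rw [map_smul, show t x = x from hx]

theorem apply_of_mem_fixed (t : V ≃ₗ[F] V) (x : fixedSubmodule t) : t x = x := x.2

/-- The map `l ⊗ s ↦ l s`. -/
noncomputable def descentMap (L : Type*) [Field L] [Algebra F L] [Module L V] [IsScalarTower F L V]
    (S : Submodule F V) : L ⊗[F] S →ₗ[F] V :=
  TensorProduct.lift (LinearMap.mk₂ F (fun (l : L) (x : S) => l • (x : V))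
    (fun _ _ _ => add_smul _ _ _) (fun _ _ _ => smul_assoc _ _ _)
    (fun _ _ _ => by simp) (fun c l x => by
      simp only [Submodule.coe_smul]
      rw [← algebraMap_smul L c (x : V), ← algebraMap_smul L c (l • (x : V)), smul_comm]))

@[simp] theorem descentMap_tmul (S : Submodule F V) (l : L) (x : S) :
    descentMap L S (l ⊗ₜ[F] x) = l • (x : V) := rfl

theorem descentMap_smul (S : Submodule F V) (l : L) (x : L ⊗[F] S) :
    descentMap L S (l • x) = l • descentMap L S x := by
  induction x using TensorProduct.induction_on with
  | zero => simp
  | tmul a s => simp [TensorProduct.smul_tmul', mul_smul]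
  | add x y hx hy => simp [hx, hy]

/-- Galois descent for a cyclic cubic extension. -/
theorem descentMap_bijective (A : CubicAlgebraWithAut F L) (t : V ≃ₗ[F] V)
    (ht : ∀ (l : L) (x : V), t (l • x) = A.ρ l • t x) (h3 : ∀ x, t (t (t x)) = x) :
    Function.Bijective (descentMap L (fixedSubmodule t)) := by
  obtain ⟨b, b', h0, h1, h2, h4⟩ := A.exists_dual_bases
  let T : V →ₗ[F] fixedSubmodule t :=
    { toFun := fun x => ⟨x + t x + t (t x), by
        change t (x + t x + t (t x)) = x + t x + t (t x)
        rw [map_add, map_add, h3]; abel⟩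
      map_add' := fun x y => Subtype.ext (by simp; abel)
      map_smul' := fun c x => Subtype.ext (by simp) }
  have hT : ∀ x, ((T x : fixedSubmodule t) : V) = x + t x + t (t x) := fun _ => rfl
  -- The inverse is built from the trace T = 1 + t + t². On l s it returns l ⊗ s, since T(b_j l s) =
  -- tr(b_j l) s. On V, the relations on the sums of b'_j ρᵏ(b_j) retain the term x of T and kill
  -- the two others.
  let g : V → L ⊗[F] fixedSubmodule t := fun x => ∑ j, b' j ⊗ₜ[F] T (b j • x)
  refine Function.bijective_iff_has_inverse.2 ⟨g, fun x => ?_, fun x => ?_⟩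
  · have hg : ∀ x y, g (x + y) = g x + g y := fun x y => by
      simp only [g, smul_add, map_add, TensorProduct.tmul_add, Finset.sum_add_distrib]
    induction x using TensorProduct.induction_on with
    | zero => simp [g]
    | add x y hx hy => rw [map_add, hg, hx, hy]
    | tmul l s =>
      have hTs : ∀ j, T (b j • descentMap L _ (l ⊗ₜ[F] s)) = A.tr (b j * l) • s := fun j => by
        apply Subtype.ext
        rw [Submodule.coe_smul, ← algebraMap_smul L (A.tr _), A.algebraMap_tr, hT, descentMap_tmul,
          smul_smul, ht, ht, apply_of_mem_fixed, apply_of_mem_fixed, add_smul, add_smul]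
      simp only [g, hTs, ← TensorProduct.smul_tmul, ← TensorProduct.sum_tmul, h0]
  · simp only [g, map_sum, descentMap_tmul, hT, ht, smul_add, smul_smul, Finset.sum_add_distrib,
      ← Finset.sum_smul, h1, h2, h4, one_smul, zero_smul, add_zero]

end Descent

/-! ### Semilinear Skolem-Noether. -/

section SkolemNoether

variable {F L V : Type*} [Field F] [Field L] [Algebra F L] [AddCommGroup V] [Module F V]
  [Module L V] [IsScalarTower F L V]

theorem semilinearInt_apply (ν : L ≃ₐ[F] L) (t : V ≃ₗ[F] V)
    (ht : ∀ (l : L) (x : V), t (l • x) = ν l • t x) (g : Module.End L V) (x : V) :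
    semilinearInt ν t ht g x = t (g (t.symm x)) := rfl

/-- The Skolem-Noether theorem for semilinear automorphisms of `End_L V`. -/
theorem exists_eq_semilinearInt (ν : L ≃ₐ[F] L) (τ : Module.End L V ≃ₐ[F] Module.End L V)
    (hτ : ∀ l : L, τ (algebraMap L _ l) = algebraMap L _ (ν l)) :
    ∃ (t : V ≃ₗ[F] V) (ht : ∀ (l : L) (x : V), t (l • x) = ν l • t x),
      τ = semilinearInt ν t ht := by
  -- Twisting V by ν⁻¹ makes τ linear over L, so the ordinary theorem applies. An L-linear map into
  -- the twisted space is a ν-semilinear map of V.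
  let f : Module.End L V ≃ₐ[L] Module.End L (Twist ν.symm V) :=
    AlgEquiv.ofRingEquiv (f := τ.toRingEquiv.trans (Twist.mkEnd ν.symm)) fun l => by
      apply LinearMap.ext
      intro x
      obtain ⟨x, rfl⟩ := (Twist.mk ν.symm).surjective x
      change Twist.mkEnd ν.symm (τ (algebraMap L _ l)) (Twist.mk ν.symm x) = _
      rw [hτ, Twist.mkEnd_apply, Module.algebraMap_end_apply, Module.algebraMap_end_apply,
        Twist.smul_mk]
      rfl
  obtain ⟨T, hT⟩ := f.eq_linearEquivConjAlgEquiv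
  have ht : ∀ (l : L) (x : V), (Twist.mk ν.symm).symm (T (l • x))
      = ν l • (Twist.mk ν.symm).symm (T x) := fun l x => by
    rw [map_smul, Twist.mk_symm_smul]; rfl
  let e : V ≃+ V := T.toAddEquiv.trans (Twist.mk ν.symm).symm
  let t : V ≃ₗ[F] V := e.toLinearEquiv fun c x => by
      rw [← algebraMap_smul L c x, ← algebraMap_smul L c (e x)]
      exact (ht _ _).trans (by rw [AlgEquiv.commutes]; rfl)
  refine ⟨t, ht, ?_⟩
  ext g x
  have h := LinearMap.congr_fun (DFunLike.congr_fun hT g) (Twist.mk ν.symm x)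
  exact h

end SkolemNoether

/-! ### Centralizers of anticommuting units. -/

section Commutant

variable {K A : Type*} [Field K] [Ring A] [Algebra K A] [FiniteDimensional K A]

/-- Centralizing a unit that anticommutes with some unit of `B` at least halves the dimension. -/
theorem two_mul_finrank_inf_centralizer_le (h2 : IsUnit (2 : A)) (B : Subalgebra K A) {a b : A}
    (ha : IsUnit a) (hb : IsUnit b) (hbB : b ∈ B) (hab : SemiconjBy a b (-b)) :
    2 * Module.finrank K (B ⊓ Subalgebra.centralizer K {a} : Subalgebra K A)
      ≤ Module.finrank K B := by
  let C : Subalgebra K A := B ⊓ Subalgebra.centralizer K {a}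
  -- Conjugation by a is 1 on C and -1 on C b. Since 2 is invertible, C and C b intersect trivially
  -- in B, and C b has the dimension of C because b is a unit.
  let φ : C × C →ₗ[K] B :=
    { toFun := fun c => ⟨c.1 + c.2 * b, B.add_mem c.1.2.1 (B.mul_mem c.2.2.1 hbB)⟩
      map_add' := fun c d => Subtype.ext (by simp [add_mul]; abel)
      map_smul' := fun k c => Subtype.ext (by simp) }
  have hφ : Function.Injective φ := by
    rw [← LinearMap.ker_eq_bot, LinearMap.ker_eq_bot']
    rintro ⟨⟨c, hc⟩, ⟨d, hd⟩⟩ h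
    have h' : c + d * b = 0 := congrArg Subtype.val h
    have hac : a * c = c * a := (Subalgebra.mem_centralizer_iff K).1 hc.2 a rfl
    have had : a * d = d * a := (Subalgebra.mem_centralizer_iff K).1 hd.2 a rfl
    have h3 : (c - d * b) * a = 0 := by
      have : a * (c + d * b) = 0 := by rw [h', mul_zero]
      rw [mul_add, ← mul_assoc, hac, had, mul_assoc, hab.eq] at this
      rw [← this]; noncomm_ring
    have h4 : c - d * b = 0 := by simpa using (ha.mul_left_eq_zero).1 h3
    have h5 : 2 * c = 0 := by
      have : 2 * c = (c + d * b) + (c - d * b) := by noncomm_ring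
      rw [this, h', h4, add_zero]
    have h6 : c = 0 := (h2.mul_right_eq_zero).1 h5
    have h7 : d = 0 := by
      rw [h6, zero_add] at h'
      exact (hb.mul_left_eq_zero).1 h'
    subst h6 h7
    rfl
  have := LinearMap.finrank_le_finrank_of_injective hφ
  rw [Module.finrank_prod] at this
  change 2 * Module.finrank K C ≤ _
  omega

omit [FiniteDimensional K A] in
theorem mem_inf_centralizer_singleton {B : Subalgebra K A} {a b : A} (hb : b ∈ B)
    (hab : SemiconjBy a b b) : b ∈ B ⊓ Subalgebra.centralizer K {a} :=
  ⟨hb, (Subalgebra.mem_centralizer_iff K).2 (by rintro _ rfl; exact hab)⟩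

/-- In an algebra of dimension at most 64, the only elements that commute with six anticommuting
units are the scalars. -/
theorem mem_bot_of_commute_anticommuting (h2 : IsUnit (2 : A)) (h64 : Module.finrank K A ≤ 64)
    (f : Fin 6 → A) (hu : ∀ i, IsUnit (f i)) (hf : ∀ i j, i ≠ j → SemiconjBy (f i) (f j) (-f j))
    {g : A} (hg : ∀ i, SemiconjBy (f i) g g) : ∃ c : K, g = algebraMap K A c := by
  rcases subsingleton_or_nontrivial A with hA | hA
  · exact ⟨0, Subsingleton.elim _ _⟩
  have hs : ∀ i, SemiconjBy (f i) (f i) (f i) := fun _ => rfl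
  -- Six halvings bring 64 = 2⁶ down to 1. Halving B_i requires a unit that commutes with f 0, ...,
  -- f (i-1) and anticommutes with f i. For i = 0, ..., 5 such units are, with q = f 0 f 1 f 2 f 3:
  -- f 1, f 0, f 0 f 1 f 3, f 0 f 1 f 2, q f 5, q f 4.
  let B0 : Subalgebra K A := ⊤
  let B1 := B0 ⊓ Subalgebra.centralizer K {f 0}
  let B2 := B1 ⊓ Subalgebra.centralizer K {f 1}
  let B3 := B2 ⊓ Subalgebra.centralizer K {f 2}
  let B4 := B3 ⊓ Subalgebra.centralizer K {f 3}
  let B5 := B4 ⊓ Subalgebra.centralizer K {f 4}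
  let B6 := B5 ⊓ Subalgebra.centralizer K {f 5}
  have mem1 {x} (h0 : SemiconjBy (f 0) x x) : x ∈ B1 :=
    mem_inf_centralizer_singleton Algebra.mem_top h0
  have mem2 {x} (h0 : SemiconjBy (f 0) x x) (h1 : SemiconjBy (f 1) x x) : x ∈ B2 :=
    mem_inf_centralizer_singleton (mem1 h0) h1
  have mem3 {x} (h0 : SemiconjBy (f 0) x x) (h1 : SemiconjBy (f 1) x x)
      (h2 : SemiconjBy (f 2) x x) : x ∈ B3 := mem_inf_centralizer_singleton (mem2 h0 h1) h2
  have mem4 {x} (h0 : SemiconjBy (f 0) x x) (h1 : SemiconjBy (f 1) x x)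
      (h2 : SemiconjBy (f 2) x x) (h3 : SemiconjBy (f 3) x x) : x ∈ B4 :=
    mem_inf_centralizer_singleton (mem3 h0 h1 h2) h3
  have mem5 {x} (h0 : SemiconjBy (f 0) x x) (h1 : SemiconjBy (f 1) x x)
      (h2 : SemiconjBy (f 2) x x) (h3 : SemiconjBy (f 3) x x) (h4 : SemiconjBy (f 4) x x) :
      x ∈ B5 := mem_inf_centralizer_singleton (mem4 h0 h1 h2 h3) h4
  have cm {i : Fin 6} {x y : A} {x' y' z : A} (hx : SemiconjBy (f i) x x')
      (hy : SemiconjBy (f i) y y') (hz : x' * y' = z) : SemiconjBy (f i) (x * y) z :=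
    hz ▸ hx.mul_right hy
  have d1 : 2 * Module.finrank K B1 ≤ Module.finrank K B0 :=
    two_mul_finrank_inf_centralizer_le h2 B0 (hu 0) (hu 1) Algebra.mem_top (hf 0 1 (by decide))
  have c01 (i : Fin 6) (h0 : i ≠ 0) (h1 : i ≠ 1) : SemiconjBy (f i) (f 0 * f 1) (f 0 * f 1) :=
    cm (hf i 0 h0) (hf i 1 h1) (by simp)
  have c01_0 : SemiconjBy (f 0) (f 0 * f 1) (-(f 0 * f 1)) :=
    cm (hs 0) (hf 0 1 (by decide)) (by simp)
  have c01_1 : SemiconjBy (f 1) (f 0 * f 1) (-(f 0 * f 1)) :=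
    cm (hf 1 0 (by decide)) (hs 1) (by simp)
  have c012 (i : Fin 6) (h2 : i ≠ 2) (h : SemiconjBy (f i) (f 0 * f 1) (-(f 0 * f 1))) :
      SemiconjBy (f i) (f 0 * f 1 * f 2) (f 0 * f 1 * f 2) :=
    cm h (hf i 2 h2) (by simp)
  have d2 : 2 * Module.finrank K B2 ≤ Module.finrank K B1 :=
    two_mul_finrank_inf_centralizer_le h2 B1 (hu 1) (hu 0) (mem1 (hs 0)) (hf 1 0 (by decide))
  have d3 : 2 * Module.finrank K B3 ≤ Module.finrank K B2 :=
    two_mul_finrank_inf_centralizer_le h2 B2 (hu 2) (((hu 0).mul (hu 1)).mul (hu 3))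
      (mem2 (cm c01_0 (hf 0 3 (by decide)) (by simp)) (cm c01_1 (hf 1 3 (by decide)) (by simp)))
      (cm (c01 2 (by decide) (by decide)) (hf 2 3 (by decide)) (by simp))
  have e0 := c012 0 (by decide) c01_0
  have e1 := c012 1 (by decide) c01_1
  have e2 : SemiconjBy (f 2) (f 0 * f 1 * f 2) (f 0 * f 1 * f 2) :=
    cm (c01 2 (by decide) (by decide)) (hs 2) rfl
  have e (i : Fin 6) (h0 : i ≠ 0) (h1 : i ≠ 1) (h2 : i ≠ 2) :
      SemiconjBy (f i) (f 0 * f 1 * f 2) (-(f 0 * f 1 * f 2)) :=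
    cm (c01 i h0 h1) (hf i 2 h2) (by simp)
  have d4 : 2 * Module.finrank K B4 ≤ Module.finrank K B3 :=
    two_mul_finrank_inf_centralizer_le h2 B3 (hu 3) (((hu 0).mul (hu 1)).mul (hu 2))
      (mem3 e0 e1 e2) (e 3 (by decide) (by decide) (by decide))
  have q0 : SemiconjBy (f 0) (f 0 * f 1 * f 2 * f 3) (-(f 0 * f 1 * f 2 * f 3)) :=
    cm e0 (hf 0 3 (by decide)) (by simp)
  have q1 : SemiconjBy (f 1) (f 0 * f 1 * f 2 * f 3) (-(f 0 * f 1 * f 2 * f 3)) :=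
    cm e1 (hf 1 3 (by decide)) (by simp)
  have q2 : SemiconjBy (f 2) (f 0 * f 1 * f 2 * f 3) (-(f 0 * f 1 * f 2 * f 3)) :=
    cm e2 (hf 2 3 (by decide)) (by simp)
  have q3 : SemiconjBy (f 3) (f 0 * f 1 * f 2 * f 3) (-(f 0 * f 1 * f 2 * f 3)) :=
    cm (e 3 (by decide) (by decide) (by decide)) (hs 3) (by simp)
  have q4 : SemiconjBy (f 4) (f 0 * f 1 * f 2 * f 3) (f 0 * f 1 * f 2 * f 3) :=
    cm (e 4 (by decide) (by decide) (by decide)) (hf 4 3 (by decide)) (by simp)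
  have q5 : SemiconjBy (f 5) (f 0 * f 1 * f 2 * f 3) (f 0 * f 1 * f 2 * f 3) :=
    cm (e 5 (by decide) (by decide) (by decide)) (hf 5 3 (by decide)) (by simp)
  have uq := (((hu 0).mul (hu 1)).mul (hu 2)).mul (hu 3)
  have d5 : 2 * Module.finrank K B5 ≤ Module.finrank K B4 :=
    two_mul_finrank_inf_centralizer_le h2 B4 (hu 4) (uq.mul (hu 5))
      (mem4 (cm q0 (hf 0 5 (by decide)) (by simp)) (cm q1 (hf 1 5 (by decide)) (by simp))
        (cm q2 (hf 2 5 (by decide)) (by simp)) (cm q3 (hf 3 5 (by decide)) (by simp)))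
      (cm q4 (hf 4 5 (by decide)) (by simp))
  have d6 : 2 * Module.finrank K B6 ≤ Module.finrank K B5 :=
    two_mul_finrank_inf_centralizer_le h2 B5 (hu 5) (uq.mul (hu 4))
      (mem5 (cm q0 (hf 0 4 (by decide)) (by simp)) (cm q1 (hf 1 4 (by decide)) (by simp))
        (cm q2 (hf 2 4 (by decide)) (by simp)) (cm q3 (hf 3 4 (by decide)) (by simp))
        (cm q4 (hs 4) rfl))
      (cm q5 (hf 5 4 (by decide)) (by simp))
  have d0 : Module.finrank K B0 ≤ 64 := by
    rwa [show Module.finrank K B0 = Module.finrank K A from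
      (Subalgebra.topEquiv (R := K) (A := A)).toLinearEquiv.finrank_eq]
  have h1 : B6 = ⊥ := by
    apply Subalgebra.eq_bot_of_finrank_one
    have : 0 < Module.finrank K B6 := Module.finrank_pos
    omega
  have hgB : g ∈ B6 :=
    mem_inf_centralizer_singleton (mem5 (hg 0) (hg 1) (hg 2) (hg 3) (hg 4)) (hg 5)
  rw [h1, Algebra.mem_bot] at hgB
  exact hgB.imp fun _ h => h.symm

end Commutant

/-! ### Triple products and their commutant. -/

namespace CyclicComposition

variable {F L V : Type*} [Field F] [Field L] [Algebra F L] [AddCommGroup V] [Module F V]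
  [Module L V] [IsScalarTower F L V] (Γ : CyclicComposition F L V)

theorem mul_smul_right (l : L) (x y : V) : Γ.mul x (l • y) = Γ.ρ (Γ.ρ l) • Γ.mul x y := by
  rw [Γ.mul_smul, pow_two, AlgEquiv.mul_apply]

theorem mul_mul_self' (x y : V) : Γ.mul (Γ.mul x y) x = Γ.ρ (Γ.ρ (Γ.Q x)) • y := by
  rw [Γ.mul_mul_self, pow_two, AlgEquiv.mul_apply]

theorem Q_add (x y : V) : Γ.Q (x + y) = Γ.Q x + Γ.Q y + Γ.Q.polarBilin x y := by
  simp [QuadraticMap.polar]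

theorem mul_mul_add (x w y : V) : Γ.mul (Γ.mul x y) w + Γ.mul (Γ.mul w y) x
    = Γ.ρ (Γ.ρ (Γ.Q.polarBilin x w)) • y := by
  have h := Γ.mul_mul_self' (x + w) y
  simp only [map_add, LinearMap.add_apply, mul_mul_self', Q_add, add_smul] at h
  rw [← sub_eq_zero] at h ⊢
  rw [← h]; abel

theorem mul_mul_add' (x w y : V) : Γ.mul x (Γ.mul y w) + Γ.mul w (Γ.mul y x)
    = Γ.ρ (Γ.Q.polarBilin x w) • y := by
  have h := Γ.self_mul_mul (x + w) y
  simp only [map_add, LinearMap.add_apply, self_mul_mul, Q_add, add_smul] at h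
  rw [← sub_eq_zero] at h ⊢
  rw [← h]; abel

/-- The `L`-linear map `z ↦ (y * z) * x`. -/
def lrMul (x y : V) : Module.End L V where
  toFun z := Γ.mul (Γ.mul y z) x
  map_add' z z' := by simp
  map_smul' l z := by
    rw [mul_smul_right, Γ.smul_mul, Γ.ρ_ρ_ρ, RingHom.id_apply]

theorem lrMul_apply (x y z : V) : Γ.lrMul x y z = Γ.mul (Γ.mul y z) x := rfl

/-- This is the Clifford relation x a y a = -Q(a) x y for a orthogonal to y, seen through the first
component of α_{*0}. The scalar Q(a) acts on ᵖV through ρ⁻¹ = ρ². -/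
theorem lrMul_mul_lrMul {a y : V} (h : Γ.Q.polarBilin a y = 0) (x : V) :
    Γ.lrMul x a * Γ.lrMul y a = -(Γ.ρ (Γ.ρ (Γ.Q a)) • Γ.lrMul x y) := by
  ext z
  have h1 := Γ.mul_mul_add' a y (Γ.mul a z)
  rw [h, map_zero, zero_smul, mul_mul_self', mul_smul_right, Γ.ρ_ρ_ρ, add_eq_zero_iff_eq_neg] at h1
  simp only [Module.End.mul_apply, lrMul_apply, h1, LinearMap.neg_apply, LinearMap.smul_apply,
    map_neg, Γ.smul_mul]

theorem lrMul_add_lrMul (x y : V) :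
    Γ.lrMul x y + Γ.lrMul y x = algebraMap L _ (Γ.ρ (Γ.ρ (Γ.Q.polarBilin x y))) := by
  ext z
  have := Γ.mul_mul_add y x z
  rw [Γ.polar_comm] at this
  simpa [lrMul_apply] using this

theorem lrMul_self (x : V) : Γ.lrMul x x = algebraMap L _ (Γ.ρ (Γ.ρ (Γ.Q x))) := by
  ext z
  simp [lrMul_apply, mul_mul_self']

theorem exists_orthogonal [Invertible (2 : F)] : ∃ e : Fin 8 → V,
    (∀ i, Γ.Q (e i) ≠ 0) ∧ ∀ i j, i ≠ j → Γ.Q.polarBilin (e i) (e j) = 0 := by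
  let : Invertible (2 : L) := (Invertible.map (algebraMap F L) 2).copy 2 (map_ofNat _ _).symm
  have := Γ.finiteDimensional
  have hs : LinearMap.IsSymm Γ.Q.polarBilin := ⟨fun x y => Γ.polar_comm x y⟩
  obtain ⟨e, he⟩ := LinearMap.BilinForm.exists_orthogonal_basis hs
  let c : Fin 8 ≃ Fin (Module.finrank L V) := finCongr Γ.finrank_module.symm
  refine ⟨fun i => e (c i), fun i h => ?_, fun i j hij => he (c.injective.ne hij)⟩
  refine he.not_isOrtho_basis_self_of_separatingLeft Γ.nondegenerate.1 (c i) ?_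
  rw [polar_self, h, mul_zero]

/-- The only endomorphisms that commute with all maps `z ↦ (y * z) * x` are the scalars. -/
theorem eq_algebraMap_of_commute [Invertible (2 : F)] (g : Module.End L V)
    (hg : ∀ x y z, g (Γ.mul (Γ.mul y z) x) = Γ.mul (Γ.mul y (g z)) x) :
    ∃ c : L, g = algebraMap L _ c := by
  let : Invertible (2 : L) := (Invertible.map (algebraMap F L) 2).copy 2 (map_ofNat _ _).symm
  have := Γ.finiteDimensional
  have := Γ.free
  obtain ⟨e, he, heo⟩ := Γ.exists_orthogonal
  -- The elements e_i e_7 of C₀(V, Q) with i < 7 anticommute pairwise. Six of them suffice in End_L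
  -- V, of dimension 2⁶; e_6 plays no role.
  let i6 : Fin 6 → Fin 8 := Fin.castLE (by norm_num)
  have i6_inj : ∀ i j, i ≠ j → i6 i ≠ i6 j := by decide
  have i6_ne : ∀ i, 7 ≠ i6 i := by decide
  have hm : ∀ i j, Γ.lrMul (e (i6 i)) (e 7) * Γ.lrMul (e (i6 j)) (e 7)
      = -(Γ.ρ (Γ.ρ (Γ.Q (e 7))) • Γ.lrMul (e (i6 i)) (e (i6 j))) := fun i j =>
    Γ.lrMul_mul_lrMul (heo _ _ (i6_ne _)) _
  have h2 : IsUnit (2 : Module.End L V) := by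
    have : IsUnit (2 : L) := isUnit_of_invertible 2
    have := this.map (algebraMap L (Module.End L V))
    rwa [map_ofNat] at this
  refine mem_bot_of_commute_anticommuting h2 ?_ (fun i => Γ.lrMul (e (i6 i)) (e 7)) (fun i => ?_)
    (fun i j hij => ?_) (fun i => ?_)
  · rw [Module.finrank_linearMap, Γ.finrank_module]
  · have h := hm i i
    rw [lrMul_self, Algebra.smul_def, ← map_mul, ← map_neg] at h
    refine isUnit_of_mul_isUnit_left (y := Γ.lrMul (e (i6 i)) (e 7)) ?_
    rw [h]
    exact (IsUnit.mk0 _ (by simp [he])).map (algebraMap L (Module.End L V))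
  · have h := Γ.lrMul_add_lrMul (e (i6 i)) (e (i6 j))
    rw [heo _ _ (i6_inj _ _ hij), map_zero, map_zero, map_zero, add_eq_zero_iff_eq_neg] at h
    change _ * _ = - _ * _
    rw [neg_mul, hm, hm, h, smul_neg]
  · ext z
    exact (hg _ _ _).symm

end CyclicComposition

/-! ### Semilinear homomorphisms out of the even Clifford algebra. -/

section SemilinearLift

/-- The algebra `B` with its scalar multiplication twisted by `ν`. -/
def RestrictAlg {F L : Type*} [Field F] [CommRing L] [Algebra F L] (_ν : L ≃ₐ[F] L) (B : Type*) :=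
  B

namespace RestrictAlg

variable {F L B : Type*} [Field F] [CommRing L] [Algebra F L] [Ring B] [Algebra L B]
  (ν : L ≃ₐ[F] L)

instance : Ring (RestrictAlg ν B) := inferInstanceAs (Ring B)

instance : Algebra L (RestrictAlg ν B) := Algebra.compHom B (ν : L →+* L)

/-- The identity map `B → RestrictAlg ν B`. -/
def mk : B ≃+* RestrictAlg ν B := RingEquiv.refl B

theorem smul_mk (l : L) (b : B) : l • mk ν b = mk ν (ν l • b) := rfl

theorem algebraMap_eq (l : L) : algebraMap L (RestrictAlg ν B) l = mk ν (algebraMap L B (ν l)) :=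
  rfl

end RestrictAlg

variable {F L V B : Type*} [Field F] [CommRing L] [Algebra F L] [AddCommGroup V] [Module L V]
  [Ring B] [Algebra L B] (Q : QuadraticForm L V) (ν : L ≃ₐ[F] L)

/-- Twisting the scalars of B by ν makes β bilinear, and the universal property of the even Clifford
algebra applies. -/
theorem exists_semilinear_even_lift (β : V →+ V →+ B)
    (hl : ∀ l x y, β (l • x) y = ν l • β x y) (hr : ∀ l x y, β x (l • y) = ν l • β x y)
    (hc : ∀ x, β x x = algebraMap L B (ν (Q x)))
    (hm : ∀ x y z, β x y * β y z = ν (Q y) • β x z) :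
    ∃ Φ : CliffordAlgebra.even Q →+* B, (∀ (l : L) c, Φ (l • c) = ν l • Φ c) ∧
      ∀ x y, Φ ((CliffordAlgebra.even.ι Q).bilin x y) = β x y := by
  let E : CliffordAlgebra.EvenHom Q (RestrictAlg ν B) :=
    { bilin := LinearMap.mk₂ L (fun x y => RestrictAlg.mk ν (β x y))
        (fun x x' y => by simp) (fun l x y => by rw [hl, RestrictAlg.smul_mk])
        (fun x y y' => by simp) (fun l x y => by rw [hr, RestrictAlg.smul_mk])
      contract := fun x => by rw [LinearMap.mk₂_apply, hc, RestrictAlg.algebraMap_eq]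
      contract_mid := fun x y z => by
        simp only [LinearMap.mk₂_apply]
        rw [← map_mul, hm, RestrictAlg.smul_mk] }
  refine ⟨(RestrictAlg.mk (B := B) ν).symm.toRingHom.comp (CliffordAlgebra.even.lift Q E).toRingHom,
    fun l c => ?_, fun x y => ?_⟩
  · change (RestrictAlg.mk ν).symm (CliffordAlgebra.even.lift Q E (l • c)) = _
    rw [map_smul]; rfl
  · change (RestrictAlg.mk ν).symm (CliffordAlgebra.even.lift Q E _) = _
    rw [CliffordAlgebra.even.lift_ι]; rfl

theorem semilinear_even_ext {Φ Ψ : CliffordAlgebra.even Q →+* B}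
    (hΦ : ∀ (l : L) c, Φ (l • c) = ν l • Φ c) (hΨ : ∀ (l : L) c, Ψ (l • c) = ν l • Ψ c)
    (h : ∀ x y, Φ ((CliffordAlgebra.even.ι Q).bilin x y)
      = Ψ ((CliffordAlgebra.even.ι Q).bilin x y)) : Φ = Ψ := by
  let toAlg (Θ : CliffordAlgebra.even Q →+* B) (hΘ : ∀ (l : L) c, Θ (l • c) = ν l • Θ c) :
      CliffordAlgebra.even Q →ₐ[L] RestrictAlg ν B :=
    AlgHom.ofLinearMap
      { toFun := fun c => RestrictAlg.mk ν (Θ c)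
        map_add' := fun c d => by simp
        map_smul' := fun l c => by rw [hΘ, RingHom.id_apply, RestrictAlg.smul_mk] }
      (by simp) (fun c d => by simp)
  have key : toAlg Φ hΦ = toAlg Ψ hΨ := by
    apply CliffordAlgebra.even.algHom_ext
    ext x y : 3
    exact h x y
  ext c
  exact DFunLike.congr_fun key c

end SemilinearLift

/-! ### Semilinear similitudes and the isomorphism C(Int(t)). -/

namespace CyclicComposition

section Similitude

variable {F L V : Type*} [Field F] [Field L] [Algebra F L] [AddCommGroup V] [Module F V]
  [Module L V] [IsScalarTower F L V] (Γ : CyclicComposition F L V)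

theorem polar_apply (x y : V) : Γ.Q.polarBilin x y = Γ.Q (x + y) - Γ.Q x - Γ.Q y := rfl

theorem cliffordMap_tensorEquivEnd (x y : V) :
    Γ.cliffordMap (Γ.tensorEquivEnd (x ⊗ₜ[L] y)) = (CliffordAlgebra.even.ι Γ.Q).bilin x y := by
  simp [cliffordMap]

theorem alphaStarZero_ι (x y : V) : Γ.alphaStarZero ((CliffordAlgebra.even.ι Γ.Q).bilin x y)
    = (Γ.r x ∘ₗ Γ.ell y, Γ.ell x ∘ₗ Γ.r y) :=
  CliffordAlgebra.even.lift_ι _ _ _ _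

variable {Γ} {ν : L ≃ₐ[F] L} {t : V ≃ₗ[F] V} {c : L}

theorem polar_similitude (hQ : ∀ x, Γ.Q (t x) = ν (c * Γ.Q x)) (x y : V) :
    Γ.Q.polarBilin (t x) (t y) = ν (c * Γ.Q.polarBilin x y) := by
  simp only [polar_apply, ← map_add, hQ, ← map_sub, mul_sub]

theorem semilinearInt_sigma (ht : ∀ (l : L) (x : V), t (l • x) = ν l • t x)
    (hQ : ∀ x, Γ.Q (t x) = ν (c * Γ.Q x)) (g : Module.End L V) :
    semilinearInt ν t ht (Γ.sigma g) = Γ.sigma (semilinearInt ν t ht g) := by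
  ext x
  refine Γ.eq_of_polar fun y => ?_
  obtain ⟨x, rfl⟩ := t.surjective x
  obtain ⟨y, rfl⟩ := t.surjective y
  rw [polar_sigma]
  simp only [semilinearInt_apply, LinearEquiv.symm_apply_apply, polar_similitude hQ, polar_sigma]

/-- The factor arises because b_Q(t y, t z) carries an extra ν(c). It matches the factor needed to
extend t to the even Clifford algebra. -/
theorem semilinearInt_tensorEquivEnd (ht : ∀ (l : L) (x : V), t (l • x) = ν l • t x)
    (hc : c ≠ 0) (hQ : ∀ x, Γ.Q (t x) = ν (c * Γ.Q x)) (x y : V) :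
    semilinearInt ν t ht (Γ.tensorEquivEnd (x ⊗ₜ[L] y))
      = (ν c)⁻¹ • Γ.tensorEquivEnd (t x ⊗ₜ[L] t y) := by
  ext z
  obtain ⟨z, rfl⟩ := t.surjective z
  rw [semilinearInt_apply, LinearMap.smul_apply, tensorEquivEnd_tmul, tensorEquivEnd_tmul,
    LinearEquiv.symm_apply_apply, ht, polar_similitude hQ, map_mul, smul_smul,
    inv_mul_cancel_left₀ (by simpa using hc)]

/-- A similitude does not extend to the full Clifford algebra, but it does to the even part:
dividing t(x) t(y) by ν(c) restores x x = Q(x) and x y y z = Q(y) x z. -/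
theorem exists_even_similitude (ht : ∀ (l : L) (x : V), t (l • x) = ν l • t x)
    (hc : c ≠ 0) (hQ : ∀ x, Γ.Q (t x) = ν (c * Γ.Q x)) :
    ∃ Φ : CliffordAlgebra.even Γ.Q →+* CliffordAlgebra.even Γ.Q,
      (∀ (l : L) d, Φ (l • d) = ν l • Φ d) ∧
      ∀ x y, Φ ((CliffordAlgebra.even.ι Γ.Q).bilin x y)
        = (ν c)⁻¹ • (CliffordAlgebra.even.ι Γ.Q).bilin (t x) (t y) := by
  have hc' : ν c ≠ 0 := by simpa using hc
  refine exists_semilinear_even_lift Γ.Q ν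
    (AddMonoidHom.mk' (fun x => AddMonoidHom.mk'
      (fun y => (ν c)⁻¹ • (CliffordAlgebra.even.ι Γ.Q).bilin (t x) (t y)) fun y y' => by
        rw [map_add, map_add, smul_add]) fun x x' => by
        ext y
        simp)
    (fun l x y => ?_) (fun l x y => ?_) (fun x => ?_) (fun x y z => ?_) <;>
    simp only [AddMonoidHom.mk'_apply, ht, map_smul, LinearMap.smul_apply]
  · rw [smul_comm]
  · rw [smul_comm]
  · rw [(CliffordAlgebra.even.ι Γ.Q).contract, hQ, Algebra.smul_def, ← map_mul, map_mul ν,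
      inv_mul_cancel_left₀ hc']
  · rw [smul_mul_smul_comm, (CliffordAlgebra.even.ι Γ.Q).contract_mid, hQ, smul_smul, smul_smul,
      map_mul]
    congr 1
    field_simp

/-- The inverse of Φ comes from t⁻¹, a ν⁻¹-semilinear similitude with factor ν(c)⁻¹. Both composites
are the identity on the generators x · y. -/
theorem exists_isCliffordInduced (ht : ∀ (l : L) (x : V), t (l • x) = ν l • t x)
    (hc : c ≠ 0) (hQ : ∀ x, Γ.Q (t x) = ν (c * Γ.Q x)) :
    ∃ Φ, Γ.IsCliffordInduced Γ ν (semilinearInt ν t ht) Φ ∧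
      ∀ x y, Φ ((CliffordAlgebra.even.ι Γ.Q).bilin x y)
        = (ν c)⁻¹ • (CliffordAlgebra.even.ι Γ.Q).bilin (t x) (t y) := by
  have hc' : ν c ≠ 0 := by simpa using hc
  have ht' : ∀ (l : L) (x : V), t.symm (l • x) = ν.symm l • t.symm x := fun l x => by
    rw [LinearEquiv.symm_apply_eq, ht, AlgEquiv.apply_symm_apply, LinearEquiv.apply_symm_apply]
  have hQ' : ∀ x, Γ.Q (t.symm x) = ν.symm ((ν c)⁻¹ * Γ.Q x) := fun x => by
    obtain ⟨x, rfl⟩ := t.surjective x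
    rw [hQ, LinearEquiv.symm_apply_apply, map_mul ν, inv_mul_cancel_left₀ hc',
      AlgEquiv.symm_apply_apply]
  obtain ⟨Φ, h1, h2⟩ := exists_even_similitude ht hc hQ
  obtain ⟨Ψ, h3, h4⟩ := exists_even_similitude ht' (inv_ne_zero hc') hQ'
  have hΨΦ : Ψ.comp Φ = RingHom.id _ := by
    refine semilinear_even_ext Γ.Q (AlgEquiv.refl : L ≃ₐ[F] L) (fun l d => ?_) (fun l d => rfl)
      fun x y => ?_
    · simp [h1, h3]
    · simp [h2, h3, h4, smul_smul, hc]
  have hΦΨ : Φ.comp Ψ = RingHom.id _ := by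
    refine semilinear_even_ext Γ.Q (AlgEquiv.refl : L ≃ₐ[F] L) (fun l d => ?_) (fun l d => rfl)
      fun x y => ?_
    · simp [h1, h3]
    · simp [h1, h2, h4, smul_smul, hc]
  refine ⟨RingEquiv.ofRingHom Φ Ψ hΦΨ hΨΦ, ⟨h1, fun g => ?_⟩, h2⟩
  obtain ⟨w, rfl⟩ := Γ.tensorEquivEnd.surjective g
  change Φ _ = _
  induction w using TensorProduct.induction_on with
  | zero => simp
  | add v w hv hw => simp only [map_add, hv, hw]
  | tmul x y =>
    rw [cliffordMap_tensorEquivEnd, h2, semilinearInt_tensorEquivEnd ht hc hQ, map_smul,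
      cliffordMap_tensorEquivEnd]

end Similitude

/-! ### Isotopies induce automorphisms of End Γ. -/

section Isotopy

variable {F L V V' V'' : Type*} [Field F] [Field L] [Algebra F L] [AddCommGroup V] [Module F V]
  [Module L V] [IsScalarTower F L V] [AddCommGroup V'] [Module F V'] [Module L V']
  [IsScalarTower F L V'] [AddCommGroup V''] [Module F V''] [Module L V''] [IsScalarTower F L V'']
  {Γ : CyclicComposition F L V} {Γ' : CyclicComposition F L V'} {Γ'' : CyclicComposition F L V''}

theorem IsIsotopy.trans {ν ν' : L ≃ₐ[F] L} {f : V ≃ₗ[F] V'} {f' : V' ≃ₗ[F] V''}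
    (h : Γ.IsIsotopy Γ' ν f) (h' : Γ'.IsIsotopy Γ'' ν' f') :
    Γ.IsIsotopy Γ'' (ν.trans ν') (f.trans f') := by
  obtain ⟨μ, hQ, hm⟩ := h.exists_multiplier
  obtain ⟨μ', hQ', hm'⟩ := h'.exists_multiplier
  refine ⟨fun l => by simp [h.comm, h'.comm], fun l x => by simp [h.semilinear, h'.semilinear],
    -- The multiplier of f' refers to the scalars of the target of f, so it is pulled back along ν.
    μ * Units.map (ν.symm : L →* L) μ', fun x => ?_, fun x y => ?_⟩
  · simp only [LinearEquiv.trans_apply, hQ', hQ, AlgEquiv.trans_apply]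
    congr 1
    simp only [Units.val_mul, Units.coe_map, MonoidHom.coe_coe, map_mul, pow_two,
      AlgEquiv.mul_apply, h.comm, AlgEquiv.apply_symm_apply]
    ring
  · simp only [LinearEquiv.trans_apply, hm', hm, h'.semilinear, AlgEquiv.trans_apply]
    simp [smul_smul, mul_comm]

theorem IsIsotopy.symm {ν : L ≃ₐ[F] L} {f : V ≃ₗ[F] V'}
    (h : Γ.IsIsotopy Γ' ν f) : Γ'.IsIsotopy Γ ν.symm f.symm := by
  obtain ⟨μ, hQ, hm⟩ := h.exists_multiplier
  have hc : ∀ l, ν.symm (Γ'.ρ l) = Γ.ρ (ν.symm l) := fun l => by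
    rw [AlgEquiv.symm_apply_eq, h.comm, AlgEquiv.apply_symm_apply]
  have hs : ∀ (l : L) x, f.symm (l • x) = ν.symm l • f.symm x := fun l x => by
    rw [LinearEquiv.symm_apply_eq, h.semilinear, AlgEquiv.apply_symm_apply,
      LinearEquiv.apply_symm_apply]
  refine ⟨hc, hs, Units.map (ν : L →* L) μ⁻¹, fun x => ?_, fun x y => ?_⟩
  · obtain ⟨x, rfl⟩ := f.surjective x
    have h1 : (μ : L) ≠ 0 := μ.ne_zero
    simp [hQ, pow_two, hc]
    field_simp
  · obtain ⟨x, rfl⟩ := f.surjective x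
    obtain ⟨y, rfl⟩ := f.surjective y
    simp [hm, hs, smul_smul]

/-- An isotopy is a similitude with c = ρ(μ) ρ²(μ), which gives the conditions on σ_Q and C(Int(t)).
Both sides of the condition on α_{*0} are ν-semilinear ring homomorphisms, so it suffices to compare
triple products on the generators x · y. -/
theorem semilinearInt_mem_autEnd {ν : L ≃ₐ[F] L} {t : V ≃ₗ[F] V} (h : Γ.IsIsotopy Γ ν t) :
    semilinearInt ν t h.semilinear ∈ Γ.autEnd := by
  obtain ⟨μ, hQ, hm⟩ := h.exists_multiplier
  have hμ : (μ : L) ≠ 0 := μ.ne_zero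
  have hc : Γ.ρ μ * (Γ.ρ ^ 2) μ ≠ 0 := by simp
  obtain ⟨Φ, h1, h2⟩ := exists_isCliffordInduced h.semilinear hc hQ
  refine ⟨semilinearInt_sigma h.semilinear hQ, ν, h.comm, fun l => ?_, Φ, h1, ?_⟩
  · ext x
    obtain ⟨x, rfl⟩ := t.surjective x
    simp [semilinearInt_apply, h.semilinear]
  let φ : Module.End L V →+* Module.End L V := semilinearInt ν t h.semilinear
  let R : CliffordAlgebra.even Γ.Q →+*
      Module.End L (Twist Γ.ρ V) × Module.End L (Twist Γ.θ V) :=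
    (RingHom.prodMap
      (((Twist.mkEnd Γ.ρ).toRingHom.comp φ).comp (Twist.mkEnd Γ.ρ).symm.toRingHom)
      (((Twist.mkEnd Γ.θ).toRingHom.comp φ).comp (Twist.mkEnd Γ.θ).symm.toRingHom)).comp
    Γ.alphaStarZero.toRingHom
  have hcρ : ∀ l, ν (Γ.ρ.symm l) = Γ.ρ.symm (ν l) := fun l => by
    rw [AlgEquiv.eq_symm_apply, ← h.comm, AlgEquiv.apply_symm_apply]
  have hcθ : ∀ l, ν (Γ.θ.symm l) = Γ.θ.symm (ν l) := fun l => by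
    simp only [CubicAlgebraWithAut.θ_symm_apply, h.comm]
  have key : Γ.alphaStarZero.toRingHom.comp Φ.toRingHom = R := by
    refine semilinear_even_ext Γ.Q ν (fun l d => ?_) (fun l d => ?_) fun x y => ?_
    · change Γ.alphaStarZero (Φ (l • d)) = ν l • Γ.alphaStarZero (Φ d)
      rw [h1.semilinear, map_smul]
    · have : R (l • d) = ((Twist.mkEnd Γ.ρ (φ ((Twist.mkEnd Γ.ρ).symm (l • (Γ.alphaStarZero d).1)))),
          (Twist.mkEnd Γ.θ (φ ((Twist.mkEnd Γ.θ).symm (l • (Γ.alphaStarZero d).2))))) := by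
        change (_, _) = _
        rw [← Prod.smul_fst, ← Prod.smul_snd, ← map_smul]
        rfl
      rw [this]
      refine Prod.ext (LinearMap.ext fun x => ?_) (LinearMap.ext fun x => ?_)
      · change t (Γ.ρ.symm l • _) = Γ.ρ.symm (ν l) • t _
        refine (h.semilinear (Γ.ρ.symm l) _).trans ?_
        rw [hcρ]
        rfl
      · change t (Γ.θ.symm l • _) = Γ.θ.symm (ν l) • t _
        refine (h.semilinear (Γ.θ.symm l) _).trans ?_
        rw [hcθ]
        rfl
    · change Γ.alphaStarZero (Φ _) = _
      have : R ((CliffordAlgebra.even.ι Γ.Q).bilin x y) =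
          ((Twist.mkEnd Γ.ρ (φ ((Twist.mkEnd Γ.ρ).symm (Γ.r x ∘ₗ Γ.ell y)))),
          (Twist.mkEnd Γ.θ (φ ((Twist.mkEnd Γ.θ).symm (Γ.ell x ∘ₗ Γ.r y))))) := by
        rw [show (Γ.r x ∘ₗ Γ.ell y) = (Γ.alphaStarZero
          ((CliffordAlgebra.even.ι Γ.Q).bilin x y)).1 by rw [alphaStarZero_ι],
          show (Γ.ell x ∘ₗ Γ.r y) = (Γ.alphaStarZero
          ((CliffordAlgebra.even.ι Γ.Q).bilin x y)).2 by rw [alphaStarZero_ι]]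
        rfl
      rw [this, h2, map_smul, alphaStarZero_ι]
      refine Prod.ext (LinearMap.ext fun z => ?_) (LinearMap.ext fun z => ?_)
      · obtain ⟨z, rfl⟩ := (Twist.mk Γ.ρ).surjective z
        obtain ⟨z, rfl⟩ := t.surjective z
        -- On ᵖV scalars act through ρ⁻¹, so ν(c)⁻¹ becomes the inverse of ν(μ ρ(μ)), the factor
        -- that t acquires in two successive products.
        change Γ.ρ.symm _ • Γ.mul (Γ.mul (t y) (t z)) (t x)
          = t (Γ.mul (Γ.mul y (t.symm (t z))) x)
        rw [LinearEquiv.symm_apply_apply, hm, Γ.smul_mul, hm, smul_smul, smul_smul]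
        convert one_smul L _
        simp only [CubicAlgebraWithAut.ρ_symm_apply, map_inv₀, map_mul, pow_two,
          AlgEquiv.mul_apply, h.comm, CubicAlgebraWithAut.ρ_ρ_ρ]
        field_simp
      · obtain ⟨z, rfl⟩ := (Twist.mk Γ.θ).surjective z
        obtain ⟨z, rfl⟩ := t.surjective z
        -- On ᶿV the scalar is twisted by θ⁻¹ = ρ, and the factor to cancel is ν(μ ρ²(μ)).
        change Γ.θ.symm _ • Γ.mul (t x) (Γ.mul (t z) (t y))
          = t (Γ.mul x (Γ.mul (t.symm (t z)) y))
        rw [LinearEquiv.symm_apply_apply, hm, Γ.mul_smul_right, hm, smul_smul, smul_smul]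
        convert one_smul L _
        simp only [CubicAlgebraWithAut.θ_symm_apply, map_inv₀, map_mul, pow_two,
          AlgEquiv.mul_apply, h.comm, CubicAlgebraWithAut.ρ_ρ_ρ]
        field_simp
  exact fun d => DFunLike.congr_fun key d

end Isotopy

end CyclicComposition

theorem two_ne_zero_of_invertible (F L : Type*) [Field F] [Field L] [Algebra F L]
    [Invertible (2 : F)] : (2 : L) ≠ 0 := by
  have := (isUnit_of_invertible (2 : F)).map (algebraMap F L)
  rw [map_ofNat] at this
  exact this.ne_zero

/-! ### From automorphisms of End Γ back to products: the multiplier μ. -/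

namespace CyclicComposition

variable {F L V : Type*} [Field F] [Field L] [Algebra F L] [AddCommGroup V] [Module F V]
  [Module L V] [IsScalarTower F L V] (Γ : CyclicComposition F L V)

theorem exists_Q_ne_zero [Invertible (2 : F)] : ∃ a, Γ.Q a ≠ 0 :=
  let ⟨e, he, _⟩ := Γ.exists_orthogonal
  ⟨e 0, he 0⟩

theorem Q_mul' (x y : V) : Γ.Q (Γ.mul x y) = Γ.ρ (Γ.Q x) * Γ.ρ (Γ.ρ (Γ.Q y)) := by
  rw [Γ.Q_mul, pow_two, AlgEquiv.mul_apply]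

theorem sigma_tensorEquivEnd (x y : V) :
    Γ.sigma (Γ.tensorEquivEnd (x ⊗ₜ[L] y)) = Γ.tensorEquivEnd (y ⊗ₜ[L] x) := by
  ext z
  refine Γ.eq_of_polar fun w => ?_
  simp only [polar_sigma, tensorEquivEnd_tmul, map_smul, LinearMap.smul_apply, smul_eq_mul,
    Γ.polar_comm z x, mul_comm]

variable {Γ} {ν : L ≃ₐ[F] L} {t : V ≃ₗ[F] V}

/-- A semilinear map whose conjugation commutes with the adjoint involution is a similitude. -/
theorem exists_similitude_of_sigma [Invertible (2 : F)]
    (ht : ∀ (l : L) (x : V), t (l • x) = ν l • t x)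
    (hσ : ∀ g, semilinearInt ν t ht (Γ.sigma g) = Γ.sigma (semilinearInt ν t ht g)) :
    ∃ c : L, c ≠ 0 ∧ ∀ x, Γ.Q (t x) = ν (c * Γ.Q x) := by
  obtain ⟨a, ha⟩ := Γ.exists_Q_ne_zero
  have h2 := two_ne_zero_of_invertible F L
  -- Commutation with σ_Q is tested on the rank one operators x ⊗ y, which σ_Q sends to y ⊗ x.
  have h : ∀ x y z w, ν (Γ.Q.polarBilin x z) * Γ.Q.polarBilin (t y) (t w)
      = ν (Γ.Q.polarBilin y w) * Γ.Q.polarBilin (t z) (t x) := fun x y z w => by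
    have := congrArg (fun g => Γ.Q.polarBilin (g (t z)) (t w))
      (hσ (Γ.tensorEquivEnd (x ⊗ₜ[L] y)))
    simpa only [polar_sigma, sigma_tensorEquivEnd, semilinearInt_apply,
      LinearEquiv.symm_apply_apply, tensorEquivEnd_tmul, ht, map_smul, LinearMap.smul_apply,
      smul_eq_mul] using this
  -- Comparing with one anisotropic vector a shows that Q(t x) / ν(Q(x)) is the constant Q(t a) /
  -- ν(Q(a)).
  have hQ : ∀ x, Γ.Q (t x) = ν (ν.symm (Γ.Q (t a)) / Γ.Q a * Γ.Q x) := fun x => by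
    have := h a x a x
    simp only [polar_self, map_mul, map_ofNat] at this
    have ha' : ν (Γ.Q a) ≠ 0 := by simpa using ha
    rw [map_mul, map_div₀, AlgEquiv.apply_symm_apply]
    field_simp
    apply mul_left_cancel₀ (mul_ne_zero h2 h2)
    linear_combination this
  refine ⟨_, fun h0 => ha ?_, hQ⟩
  have := hQ (t.symm a)
  rwa [LinearEquiv.apply_symm_apply, h0, zero_mul, map_zero] at this

theorem algebraMap_end_injective (Γ : CyclicComposition F L V) :
    Function.Injective (algebraMap L (Module.End L V)) := by
  have : Nontrivial V := Module.nontrivial_of_finrank_pos (R := L) (by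
    rw [Γ.finrank_module]; norm_num)
  exact (algebraMap L (Module.End L V)).injective

/-- The identities on triple products that express compatibility with `α_{*0}`. -/
theorem mul_mul_of_mem_autEnd (ht : ∀ (l : L) (x : V), t (l • x) = Γ.ρ l • t x)
    {c : L} (hc : c ≠ 0) (hQ : ∀ x, Γ.Q (t x) = Γ.ρ (c * Γ.Q x))
    (hmem : semilinearInt Γ.ρ t ht ∈ Γ.autEnd) (x y z : V) :
    Γ.mul (Γ.mul (t y) (t z)) (t x) = c • t (Γ.mul (Γ.mul y z) x) ∧
    Γ.mul (t x) (Γ.mul (t z) (t y)) = Γ.ρ (Γ.ρ c) • t (Γ.mul x (Γ.mul z y)) := by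
  obtain ⟨-, ν, -, hν, Φ, hΦ, hα⟩ := hmem
  -- Membership in `autEnd` provides some ν; the action of Int(t) on the center identifies it with
  -- ρ.
  have hνρ : ∀ l, ν l = Γ.ρ l := fun l => by
    apply Γ.algebraMap_end_injective
    rw [← hν]
    ext x
    obtain ⟨x, rfl⟩ := t.surjective x
    simp [semilinearInt_apply, ht]
  have h1 : Φ ((CliffordAlgebra.even.ι Γ.Q).bilin x y)
      = (Γ.ρ c)⁻¹ • (CliffordAlgebra.even.ι Γ.Q).bilin (t x) (t y) := by
    rw [← cliffordMap_tensorEquivEnd, hΦ.map_cliffordMap, semilinearInt_tensorEquivEnd ht hc hQ,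
      map_smul, cliffordMap_tensorEquivEnd]
  have h2 := hα ((CliffordAlgebra.even.ι Γ.Q).bilin x y)
  rw [h1, map_smul, alphaStarZero_ι, alphaStarZero_ι, Prod.ext_iff] at h2
  have h3 : Γ.ρ.symm (Γ.ρ c)⁻¹ • Γ.mul (Γ.mul (t y) (t z)) (t x)
      = t (Γ.mul (Γ.mul y (t.symm (t z))) x) :=
    LinearMap.congr_fun h2.1 (Twist.mk Γ.ρ (t z))
  have h4 : Γ.θ.symm (Γ.ρ c)⁻¹ • Γ.mul (t x) (Γ.mul (t z) (t y))
      = t (Γ.mul x (Γ.mul (t.symm (t z)) y)) :=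
    LinearMap.congr_fun h2.2 (Twist.mk Γ.θ (t z))
  rw [LinearEquiv.symm_apply_apply] at h3 h4
  rw [← h3, ← h4, smul_smul, smul_smul]
  simp [CubicAlgebraWithAut.θ_symm_apply, hc]

/-- The relation a * (x * a) = ρ(Q(a)) x can be divided by ρ(Q(a)). -/
theorem exists_mul_eq (Γ : CyclicComposition F L V) {a : V} (ha : Γ.Q a ≠ 0) (x : V) :
    ∃ y z, Γ.mul y z = x := by
  refine ⟨(Γ.Q a)⁻¹ • a, Γ.mul x a, ?_⟩
  rw [Γ.smul_mul, Γ.self_mul_mul, smul_smul, map_inv₀, inv_mul_cancel₀ (by simpa using ha),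
    one_smul]

/-- The map u measures the failure of t to be multiplicative. The two triple product identities
force it into the centralizer of all maps z ↦ (y * z) * x, which consists of scalars. -/
theorem exists_mul_eq_smul [Invertible (2 : F)] (ht : ∀ (l : L) (x : V), t (l • x) = Γ.ρ l • t x)
    {c : L} (hc : c ≠ 0) (hQ : ∀ x, Γ.Q (t x) = Γ.ρ (c * Γ.Q x))
    (hA : ∀ x y z, Γ.mul (Γ.mul (t y) (t z)) (t x) = c • t (Γ.mul (Γ.mul y z) x))
    (hB : ∀ x y z, Γ.mul (t x) (Γ.mul (t z) (t y)) = Γ.ρ (Γ.ρ c) • t (Γ.mul x (Γ.mul z y))) :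
    ∃ μ : L, ∀ x y, Γ.mul (t x) (t y) = μ • t (Γ.mul x y) := by
  obtain ⟨a, ha⟩ := Γ.exists_Q_ne_zero
  have ht' : ∀ (l : L) (x : V), t.symm (l • x) = Γ.ρ.symm l • t.symm x := fun l x => by
    rw [LinearEquiv.symm_apply_eq, ht, AlgEquiv.apply_symm_apply, LinearEquiv.apply_symm_apply]
  -- The required rule t(u(y * w)) = t(y) * t(w) is not visibly well defined. The formula is
  -- obtained by recovering t(y) * t(w) from its product with t(a) on the right, which `hA`
  -- expresses through y * w.
  let u : Module.End L V :=
    { toFun := fun p => (Γ.ρ (Γ.Q a))⁻¹ • t.symm (Γ.mul (t a) (t (Γ.mul p a)))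
      map_add' := fun p q => by simp
      map_smul' := fun l p => by
        rw [Γ.smul_mul, ht, mul_smul_right, ht', Γ.ρ_ρ_ρ, AlgEquiv.symm_apply_apply, smul_comm,
          RingHom.id_apply] }
  have hu : ∀ y w, t (u (Γ.mul y w)) = Γ.mul (t y) (t w) := fun y w => by
    have h1 : t (Γ.mul (Γ.mul y w) a) = c⁻¹ • Γ.mul (Γ.mul (t y) (t w)) (t a) := by
      rw [hA, smul_smul, inv_mul_cancel₀ hc, one_smul]
    change t ((Γ.ρ (Γ.Q a))⁻¹ • t.symm (Γ.mul (t a) (t (Γ.mul (Γ.mul y w) a)))) = _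
    rw [ht, LinearEquiv.apply_symm_apply, h1, mul_smul_right, Γ.self_mul_mul, hQ, smul_smul,
      smul_smul]
    convert one_smul L _
    simp only [map_inv₀, map_mul]
    field_simp [hc, ha]
  have huA : ∀ w x, u (Γ.mul (u w) x) = Γ.ρ (Γ.ρ c) • Γ.mul w x := fun w x => by
    obtain ⟨p, q, rfl⟩ := Γ.exists_mul_eq ha w
    apply t.injective
    rw [hu, hu, hA, ht, Γ.ρ_ρ_ρ]
  have huB : ∀ x w, u (Γ.mul x (u w)) = Γ.ρ c • Γ.mul x w := fun x w => by
    obtain ⟨p, q, rfl⟩ := Γ.exists_mul_eq ha w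
    apply t.injective
    rw [hu, hu, hB, ht]
  -- Writing y * z through `huB` as a multiple of u(y * u(z)) and then applying `huA` moves u past
  -- both products; the two factors ρ²(c) cancel.
  obtain ⟨d, hd⟩ := Γ.eq_algebraMap_of_commute u fun x y z => by
    have h1 : Γ.mul y z = (Γ.ρ c)⁻¹ • u (Γ.mul y (u z)) := by
      rw [huB, smul_smul, inv_mul_cancel₀ (by simpa using hc), one_smul]
    rw [h1, Γ.smul_mul, map_smul, huA, smul_smul, map_inv₀, inv_mul_cancel₀ (by simpa using hc),
      one_smul]
  refine ⟨Γ.ρ d, fun x y => ?_⟩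
  rw [← hu, hd, Module.algebraMap_end_apply, ht]

/-- Cyclicity of b_Q(x * y, z) makes k = μ ρ(c) invariant under ρ, and multiplicativity of Q gives
μ² ρ(c) = ρ²(c) c. Substituting c = k / ρ²(μ) and its conjugates yields k = μ ρ(μ) ρ²(μ). -/
theorem multiplier_eq [Invertible (2 : F)]
    {c μ : L} (hc : c ≠ 0) (hQ : ∀ x, Γ.Q (t x) = Γ.ρ (c * Γ.Q x))
    (hm : ∀ x y, Γ.mul (t x) (t y) = μ • t (Γ.mul x y)) :
    μ ≠ 0 ∧ Γ.ρ c = Γ.ρ μ * Γ.ρ (Γ.ρ μ) := by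
  obtain ⟨a, ha⟩ := Γ.exists_Q_ne_zero
  have haa : Γ.Q (Γ.mul a a) ≠ 0 := by simp [Q_mul', ha]
  have h2 := two_ne_zero_of_invertible F L
  have h1 : μ * Γ.ρ c = Γ.ρ (μ * Γ.ρ c) := by
    have h3 := Γ.polar_mul (t a) (t a) (t (Γ.mul a a))
    have h4 := Γ.polar_mul a a (Γ.mul a a)
    rw [hm, hm, map_smul, map_smul, LinearMap.smul_apply, LinearMap.smul_apply,
      polar_similitude hQ, polar_similitude hQ, smul_eq_mul, smul_eq_mul, map_mul Γ.ρ c,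
      map_mul Γ.ρ c, ← h4, ← mul_assoc, ← mul_assoc, map_mul Γ.ρ (_ * _)] at h3
    refine mul_right_cancel₀ ?_ h3
    rw [polar_self]
    simp [haa, h2]
  have h5 : μ ^ 2 * Γ.ρ c = Γ.ρ (Γ.ρ c) * c := by
    have h6 := congrArg Γ.Q (hm a a)
    rw [Q_mul', hQ, QuadraticMap.map_smul, hQ, Q_mul'] at h6
    simp only [map_mul, Γ.ρ_ρ_ρ, smul_eq_mul] at h6
    have h7 : Γ.ρ (Γ.ρ (Γ.Q a)) * Γ.Q a ≠ 0 := by simp [ha]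
    apply mul_right_cancel₀ h7
    linear_combination -h6
  have hμ : μ ≠ 0 := by
    rintro rfl
    simp [hc] at h5
  refine ⟨hμ, ?_⟩
  have h8 := congrArg Γ.ρ h1
  simp only [map_mul, Γ.ρ_ρ_ρ] at h1 h8
  have hne : μ ^ 2 * Γ.ρ c ≠ 0 := by simp [hc, hμ]
  apply mul_left_cancel₀ hne
  linear_combination (μ * Γ.ρ c + Γ.ρ μ * Γ.ρ (Γ.ρ c)) * h1 + Γ.ρ μ * Γ.ρ (Γ.ρ c) * h8
    - Γ.ρ μ * Γ.ρ (Γ.ρ μ) * h5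

end CyclicComposition

/-! ### Order three and the symmetric composition of fixed vectors. -/

namespace CyclicComposition

variable {F L V : Type*} [Field F] [Field L] [Algebra F L] [AddCommGroup V] [Module F V]
  [Module L V] [IsScalarTower F L V] {Γ : CyclicComposition F L V} {t : V ≃ₗ[F] V}

/-- If the cube of `Int(t)` is trivial, then `t³` is the norm of the multiplier of `t`. -/
theorem apply_apply_apply_eq [Invertible (2 : F)] (ht : ∀ (l : L) (x : V), t (l • x) = Γ.ρ l • t x)
    {μ : L} (hm : ∀ x y, Γ.mul (t x) (t y) = μ • t (Γ.mul x y))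
    (h3 : semilinearInt Γ.ρ t ht ^ 3 = 1) (x : V) :
    t (t (t x)) = (μ * Γ.ρ μ * Γ.ρ (Γ.ρ μ)) • x := by
  obtain ⟨a, ha⟩ := Γ.exists_Q_ne_zero
  have haa : Γ.Q (Γ.mul a a) ≠ 0 := by simp [Q_mul', ha]
  have hb : Γ.Q.polarBilin a a ≠ 0 := by
    rw [polar_self]
    exact mul_ne_zero (two_ne_zero_of_invertible F L) ha
  have hcomm : ∀ (g : Module.End L V) x, t (t (t (g x))) = g (t (t (t x))) := fun g x => by
    have := LinearMap.congr_fun (DFunLike.congr_fun h3 g) (t (t (t x)))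
    simpa [pow_succ, AlgEquiv.mul_apply, semilinearInt_apply] using this
  -- An additive map commuting with all of End_L V is a scalar: apply the commutation with the rank
  -- one operator x ⊗ a to the vector a.
  obtain ⟨ξ, hξ⟩ : ∃ ξ : L, ∀ x, t (t (t x)) = ξ • x := by
    refine ⟨(Γ.Q.polarBilin a a)⁻¹ * Γ.Q.polarBilin a (t (t (t a))), fun x => ?_⟩
    have := hcomm (Γ.tensorEquivEnd (x ⊗ₜ[L] a)) a
    rw [tensorEquivEnd_tmul, tensorEquivEnd_tmul, ht, ht, ht, Γ.ρ_ρ_ρ] at this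
    rw [SemigroupAction.mul_smul, ← this, smul_smul, inv_mul_cancel₀ hb, one_smul]
  have hinj : ∀ {v : V}, Γ.Q v ≠ 0 → ∀ {p q : L}, p • v = q • v → p = q := fun hv p q h => by
    refine smul_left_injective L (fun h0 => hv ?_) h
    rw [h0, map_zero]
  have hta : t a ≠ 0 := fun h0 => ha (by rw [(LinearEquiv.map_eq_zero_iff t).1 h0, map_zero])
  have hρξ : Γ.ρ ξ = ξ := by
    have h := hξ (t a)
    rw [hξ a, ht] at h
    exact smul_left_injective L hta h
  have hξ0 : ξ ≠ 0 := fun h0 => by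
    have := hξ a
    rw [h0, zero_smul] at this
    simp only [LinearEquiv.map_eq_zero_iff] at this
    exact hta (by rw [this, map_zero])
  -- Since ρ fixes ξ, applying t three times to a * a compares ξ² with μ ρ(μ) ρ²(μ) ξ.
  have h4 : Γ.mul (t (t (t a))) (t (t (t a)))
      = (μ * Γ.ρ μ * Γ.ρ (Γ.ρ μ)) • t (t (t (Γ.mul a a))) := by
    simp only [hm, ht, smul_smul, map_mul, mul_assoc]
  rw [hξ, hξ, Γ.smul_mul, mul_smul_right, hρξ, hρξ, smul_smul, smul_smul] at h4
  rw [hξ, mul_right_cancel₀ hξ0 (hinj haa h4)]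

variable [Invertible (2 : F)]

theorem tau_eq_semilinearInt {S : Type*} [AddCommGroup S] [Module F S]
    {Sg : SymmetricComposition F S} {f : L ⊗[F] S ≃ₗ[F] V}
    (hf : (Sg.tensor Γ.toCubicAlgebraWithAut).IsLinearIsotopy Γ f) {ν : L ≃ₐ[F] L}
    (ht : ∀ (l : L) (x : V), t (l • x) = ν l • t x) (h : ∀ x, f (hatMap S Γ.ρ x) = t (f x)) :
    tau hf = semilinearInt ν t ht := by
  have h' : ∀ x, (hatMap S Γ.ρ).symm (f.symm x) = f.symm (t.symm x) := fun x => by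
    rw [LinearEquiv.symm_apply_eq, LinearEquiv.symm_apply_eq, h, LinearEquiv.apply_symm_apply,
      LinearEquiv.apply_symm_apply]
  ext g x
  rw [tau_apply, semilinearInt_apply, h, LinearEquiv.apply_symm_apply, h',
    LinearEquiv.apply_symm_apply]

/-- The symmetric composition on the fixed vectors of a semilinear map of order 3. -/
theorem exists_symmetricComposition (ht : ∀ (l : L) (x : V), t (l • x) = Γ.ρ l • t x)
    (h3 : ∀ x, t (t (t x)) = x) {μ : L} (hμ : μ ≠ 0)
    (hm : ∀ x y, (Γ.ρ μ * Γ.ρ (Γ.ρ μ)) • Γ.mul (t x) (t y) = μ ^ 2 • t (Γ.mul x y))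
    (hQ : ∀ x, μ ^ 2 * Γ.Q (t x) = Γ.ρ μ * Γ.ρ (Γ.ρ μ) * Γ.ρ (Γ.Q x)) :
    ∃ (Sg : SymmetricComposition F (fixedSubmodule t)) (f : L ⊗[F] fixedSubmodule t ≃ₗ[F] V),
      (Sg.tensor Γ.toCubicAlgebraWithAut).IsLinearIsotopy Γ f ∧
      ∀ x, f (hatMap _ Γ.ρ x) = t (f x) := by
  have hμ1 : Γ.ρ μ ≠ 0 := by simpa using hμ
  have hμ2 : Γ.ρ (Γ.ρ μ) ≠ 0 := by simpa using hμ
  have hinj := (algebraMap F L).injective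
  -- On fixed vectors t multiplies x * y by ρ(μ) ρ²(μ) / μ². The element η solves ρ(η) / η = μ² /
  -- (ρ(μ) ρ²(μ)), so t fixes η (x * y) and ρ fixes η⁻¹ Q(x). It has norm 1.
  let η : L := Γ.ρ (Γ.ρ μ) / μ
  have hη : η ≠ 0 := div_ne_zero hμ2 hμ
  have hρη : Γ.ρ η = μ / Γ.ρ μ := by simp only [η, map_div₀, Γ.ρ_ρ_ρ]
  have hmS : ∀ x y : fixedSubmodule t, t (η • Γ.mul (x : V) (y : V)) = η • Γ.mul (x : V) y :=
    fun x y => by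
      have h := hm x y
      rw [apply_of_mem_fixed, apply_of_mem_fixed] at h
      have h' : t (Γ.mul (x : V) y)
          = ((μ ^ 2)⁻¹ * (Γ.ρ μ * Γ.ρ (Γ.ρ μ))) • Γ.mul (x : V) y := by
        rw [SemigroupAction.mul_smul, h, smul_smul, inv_mul_cancel₀ (pow_ne_zero 2 hμ), one_smul]
      rw [ht, h', smul_smul, hρη]
      congr 1
      simp only [η]
      field_simp
  have hQS : ∀ x : fixedSubmodule t, Γ.ρ (η⁻¹ * Γ.Q x) = η⁻¹ * Γ.Q x := fun x => by
    have h := hQ x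
    rw [apply_of_mem_fixed] at h
    rw [map_mul, map_inv₀, hρη]
    simp only [η]
    field_simp
    linear_combination -h
  choose n₀ hn₀ using fun x => Γ.eq_algebraMap_of_ρ_eq (hQS x)
  have hb₀ : ∀ x y, algebraMap F L (QuadraticMap.polar n₀ x y)
      = η⁻¹ * Γ.Q.polarBilin (x : V) y := fun x y => by
    simp only [QuadraticMap.polar, map_sub, hn₀, polar_apply, Submodule.coe_add]
    ring
  let n : QuadraticForm F (fixedSubmodule t) := QuadraticMap.ofPolar n₀
    (fun c x => hinj (by
      rw [hn₀, smul_eq_mul, map_mul, hn₀, Submodule.coe_smul, ← algebraMap_smul L c (x : V),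
        QuadraticMap.map_smul, smul_eq_mul, map_mul]
      ring))
    (fun x x' y => hinj (by
      simp only [map_add, hb₀, Submodule.coe_add, LinearMap.add_apply, mul_add]))
    (fun c x y => hinj (by
      rw [hb₀, smul_eq_mul, map_mul, hb₀, Submodule.coe_smul, ← algebraMap_smul L c (x : V),
        map_smul, LinearMap.smul_apply, smul_eq_mul]
      ring))
  have hn : ∀ x, algebraMap F L (n x) = η⁻¹ * Γ.Q (x : V) := hn₀
  have hb : ∀ x y, algebraMap F L (n.polarBilin x y) = η⁻¹ * Γ.Q.polarBilin (x : V) y := hb₀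
  let m : fixedSubmodule t →ₗ[F] fixedSubmodule t →ₗ[F] fixedSubmodule t := LinearMap.mk₂ F
    (fun x y => ⟨η • Γ.mul (x : V) (y : V), hmS x y⟩)
    (fun x x' y => Subtype.ext (by simp)) (fun c x y => Subtype.ext (by simpa using smul_comm η c _))
    (fun x y y' => Subtype.ext (by simp)) (fun c x y => Subtype.ext (by simpa using smul_comm η c _))
  have hmul : ∀ x y, ((m x y : fixedSubmodule t) : V) = η • Γ.mul (x : V) y := fun _ _ => rfl
  have hbij := descentMap_bijective Γ.toCubicAlgebraWithAut t ht h3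
  let f : L ⊗[F] fixedSubmodule t ≃ₗ[F] V := LinearEquiv.ofBijective (descentMap L _) hbij
  have hf : ∀ (l : L) (x : fixedSubmodule t), f (l ⊗ₜ[F] x) = l • (x : V) := fun _ _ => rfl
  have hfs : ∀ (l : L) x, f (l • x) = l • f x := descentMap_smul _
  let fL : L ⊗[F] fixedSubmodule t ≃ₗ[L] V :=
    { f.toAddEquiv with map_smul' := hfs }
  have hrank : Module.finrank F (fixedSubmodule t) = 8 := by
    rw [← Γ.finrank_module, ← fL.finrank_eq, Module.finrank_baseChange]
  have hpol : ∀ x : V, (∀ y : fixedSubmodule t, Γ.Q.polarBilin x y = 0) → x = 0 := fun x hx => by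
    refine Γ.nondegenerate.1 x fun v => ?_
    obtain ⟨v, rfl⟩ := f.surjective v
    induction v using TensorProduct.induction_on with
    | zero => simp
    | tmul l y => rw [hf, map_smul, hx, smul_zero]
    | add v w hv hw => rw [map_add, map_add, hv, hw, add_zero]
  have hnl : ∀ x, (∀ y, n.polarBilin x y = 0) → x = 0 := fun x hx => by
    refine Subtype.ext (hpol x fun y => ?_)
    have := hb x y
    rw [hx, map_zero] at this
    exact (mul_eq_zero.1 this.symm).resolve_left (inv_ne_zero hη)
  let Sg : SymmetricComposition F (fixedSubmodule t) :=
    { finrank_eq := hrank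
      n := n
      nondegenerate := ⟨hnl, fun y hy => hnl y fun x => by
        rw [← hy x]
        exact QuadraticMap.polar_comm _ _ _⟩
      mul := m
      n_mul := fun x y => hinj (by
        -- Q(x * y) involves ρ(Q(x)) and ρ²(Q(y)). As n takes values in F, its values at x and y may
        -- be replaced by their images under ρ and ρ²; then η ρ(η) ρ²(η) = 1 finishes.
        rw [map_mul, hn, hn, hn, hmul, QuadraticMap.map_smul, Q_mul', smul_eq_mul]
        have hx := hQS x
        have hy := (congrArg Γ.ρ (hQS y)).trans (hQS y)
        rw [← hx, ← hy]
        simp only [map_mul, map_inv₀, hρη, map_div₀]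
        simp only [η]
        field_simp)
      polar_mul := fun x y z => hinj (by
        -- Associativity of b_n is the cyclic identity for b_Q, whose outer ρ disappears on values
        -- in F.
        have h1 := congrArg (algebraMap F L) (QuadraticMap.polar_comm n x (m y z))
        have h2 := hb (m y z) x
        have h4 := congrArg Γ.ρ h2
        rw [AlgEquiv.commutes] at h4
        change algebraMap F L (n.polarBilin x (m y z)) = algebraMap F L (n.polarBilin (m y z) x)
          at h1
        rw [h1, h4, hb, hmul, hmul, map_smul, map_smul, LinearMap.smul_apply, LinearMap.smul_apply,
          smul_eq_mul, smul_eq_mul, inv_mul_cancel_left₀ hη, inv_mul_cancel_left₀ hη,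
          Γ.polar_mul]) }
  have hbil : ∀ v w, Γ.Q.polarBilin (f v) (f w)
      = η * ((Sg.n.baseChange L).polarBilin v w) := fun v w => by
    induction v using TensorProduct.induction_on with
    | zero => simp only [map_zero, LinearMap.zero_apply, mul_zero]
    | add v v' hv hv' => simp only [map_add, LinearMap.add_apply, hv, hv', mul_add]
    | tmul l x =>
    induction w using TensorProduct.induction_on with
    | zero => simp only [map_zero, mul_zero]
    | add v v' hv hv' => simp only [map_add, hv, hv', mul_add]
    | tmul l' y =>
      rw [polar_baseChange_tmul, hf, hf, map_smul, map_smul, LinearMap.smul_apply,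
        Algebra.smul_def (R := F) (A := L)]
      change _ = η * (algebraMap F L (n.polarBilin x y) * _)
      rw [hb, smul_eq_mul, smul_eq_mul]
      field_simp
  -- The multiplier is η⁻¹ because the product of S is η times that of V; the form agrees since
  -- ρ(η⁻¹) ρ²(η⁻¹) = η.
  refine ⟨Sg, f, ⟨fun l => rfl, hfs, Units.mk0 η⁻¹ (inv_ne_zero hη), fun v => ?_, fun v w => ?_⟩,
    fun v => ?_⟩
  · apply mul_left_cancel₀ (two_ne_zero_of_invertible F L)
    change 2 * Γ.Q (f v) = 2 * (Γ.ρ η⁻¹ * (Γ.ρ ^ 2) η⁻¹ * Sg.n.baseChange L v)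
    have h5 : Γ.ρ η⁻¹ * (Γ.ρ ^ 2) η⁻¹ = η := by
      simp only [pow_two, AlgEquiv.mul_apply, map_inv₀, hρη, map_div₀]
      simp only [η]
      field_simp
    rw [h5, ← polar_self, hbil, polar_self]
    ring
  · change Γ.mul (f v) (f w) = η⁻¹ • f (Sg.inducedMul Γ.ρ v w)
    induction v using TensorProduct.induction_on with
    | zero => simp
    | add v v' hv hv' => simp only [map_add, LinearMap.add_apply, hv, hv', smul_add]
    | tmul l x =>
    induction w using TensorProduct.induction_on with
    | zero => simp
    | add v v' hv hv' => simp only [map_add, hv, hv', smul_add]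
    | tmul l' y =>
      rw [SymmetricComposition.inducedMul_apply, hatMap_tmul, hatMap_tmul, extendMul_tmul, hf, hf,
        hf, Γ.smul_mul, Γ.mul_smul]
      change _ = η⁻¹ • _ • η • Γ.mul (x : V) y
      rw [smul_smul, smul_smul, smul_smul]
      congr 1
      field_simp
  · induction v using TensorProduct.induction_on with
    | zero => simp
    | add v v' hv hv' => simp only [map_add, hv, hv']
    | tmul l x => rw [hatMap_tmul, hf, hf, ht, apply_of_mem_fixed]

end CyclicComposition

/-! ### The automorphisms τ and the proof of the theorem. -/

section Automorphisms

variable {F L V : Type*} [Field F] [Field L] [Algebra F L] [AddCommGroup V] [Module F V]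
  [Module L V] [IsScalarTower F L V] {Γ : CyclicComposition F L V}
  {S S' : Type*} [AddCommGroup S] [Module F S] [AddCommGroup S'] [Module F S']
  [Invertible (2 : F)] {Sg : SymmetricComposition F S} {Sg' : SymmetricComposition F S'}

/-- The form n_L and the product ⋆_L are defined over F, hence equivariant under ρ ⊗ Id, which
moreover commutes with its own powers. -/
theorem SymmetricComposition.isIsotopy_hatMap (Sg : SymmetricComposition F S)
    (A : CubicAlgebraWithAut F L) :
    (Sg.tensor A).IsIsotopy (Sg.tensor A) A.ρ (hatMap S A.ρ) := by
  refine ⟨fun l => rfl, hatMap_smul _, 1, fun x => ?_, fun x y => ?_⟩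
  · change Sg.n.baseChange L (hatMap S A.ρ x) = A.ρ (A.ρ (1 : Lˣ) * (A.ρ ^ 2) (1 : Lˣ) *
      Sg.n.baseChange L x)
    rw [Sg.n_hatMap]
    simp
  · change Sg.inducedMul A.ρ _ _ = A.ρ (1 : Lˣ) • hatMap S A.ρ (Sg.inducedMul A.ρ x y)
    rw [Units.val_one, map_one, one_smul, inducedMul_apply, inducedMul_apply, hatMap_extendMul,
      hatMap_hatMap (A.ρ ^ 2), hatMap_hatMap A.ρ (A.ρ ^ 2), (Commute.pow_self A.ρ 2).eq]

theorem CyclicComposition.IsIsotopy.conjHat {f : L ⊗[F] S ≃ₗ[F] V}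
    (hf : (Sg.tensor Γ.toCubicAlgebraWithAut).IsLinearIsotopy Γ f) :
    Γ.IsIsotopy Γ Γ.ρ (conjHat Γ.ρ f) :=
  (IsIsotopy.symm hf).trans ((Sg.isIsotopy_hatMap Γ.toCubicAlgebraWithAut).trans hf)

theorem tau_mem_autEnd {f : L ⊗[F] S ≃ₗ[F] V}
    (hf : (Sg.tensor Γ.toCubicAlgebraWithAut).IsLinearIsotopy Γ f) : tau hf ∈ Γ.autEnd :=
  CyclicComposition.semilinearInt_mem_autEnd (CyclicComposition.IsIsotopy.conjHat hf)

omit [Invertible (2 : F)] in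
theorem hatMap_hatMap_hatMap (A : CubicAlgebraWithAut F L) (x : L ⊗[F] S) :
    hatMap S A.ρ (hatMap S A.ρ (hatMap S A.ρ x)) = x := by
  induction x using TensorProduct.induction_on with
  | zero => simp
  | tmul l s => simp [A.ρ_ρ_ρ]
  | add x y hx hy => simp only [map_add, hx, hy]

theorem tau_pow_three {f : L ⊗[F] S ≃ₗ[F] V}
    (hf : (Sg.tensor Γ.toCubicAlgebraWithAut).IsLinearIsotopy Γ f) : tau hf ^ 3 = 1 := by
  have h : ∀ x : L ⊗[F] S, (hatMap S Γ.ρ).symm ((hatMap S Γ.ρ).symm ((hatMap S Γ.ρ).symm x)) = x :=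
    fun x => by
      simp only [LinearEquiv.symm_apply_eq]
      exact (hatMap_hatMap_hatMap Γ.toCubicAlgebraWithAut x).symm
  ext g x
  simp [pow_succ, AlgEquiv.mul_apply, tau_apply, hatMap_hatMap_hatMap, h]

theorem tau_algebraMap {f : L ⊗[F] S ≃ₗ[F] V}
    (hf : (Sg.tensor Γ.toCubicAlgebraWithAut).IsLinearIsotopy Γ f) (l : L) :
    tau hf (algebraMap L (Module.End L V) l) = algebraMap L (Module.End L V) (Γ.ρ l) := by
  ext x
  obtain ⟨x, rfl⟩ := (conjHat Γ.ρ f).surjective x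
  change conjHat Γ.ρ f (l • (conjHat Γ.ρ f).symm _) = Γ.ρ l • _
  rw [conjHat_smul hf, LinearEquiv.apply_symm_apply]
  rfl

/-- The extension of scalars `L ⊗ S → L ⊗ S'` of a linear isomorphism. -/
noncomputable def extendEquiv (L : Type*) [Field L] [Algebra F L] (e : S ≃ₗ[F] S') :
    L ⊗[F] S ≃ₗ[F] L ⊗[F] S' :=
  TensorProduct.congr (LinearEquiv.refl F L) e

omit [Invertible (2 : F)] in
@[simp] theorem extendEquiv_tmul (e : S ≃ₗ[F] S') (l : L) (x : S) :
    extendEquiv L e (l ⊗ₜ[F] x) = l ⊗ₜ[F] e x := rfl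

omit [Invertible (2 : F)] in
theorem extendEquiv_hatMap (e : S ≃ₗ[F] S') (ν : L ≃ₐ[F] L) (x : L ⊗[F] S) :
    extendEquiv L e (hatMap S ν x) = hatMap S' ν (extendEquiv L e x) := by
  induction x using TensorProduct.induction_on with
  | zero => simp
  | tmul l s => simp
  | add x y hx hy => simp only [map_add, hx, hy]

theorem SymmetricComposition.IsIsomorphism.extendEquiv {e : S ≃ₗ[F] S'}
    (he : Sg.IsIsomorphism Sg' e) (A : CubicAlgebraWithAut F L) :
    (Sg.tensor A).IsLinearIsotopy (Sg'.tensor A) (extendEquiv L e) := by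
  have hpol : ∀ x y : L ⊗[F] S, (Sg'.n.baseChange L).polarBilin (_root_.extendEquiv L e x)
      (_root_.extendEquiv L e y) = (Sg.n.baseChange L).polarBilin x y := fun x y => by
    induction x using TensorProduct.induction_on with
    | zero => simp only [map_zero, LinearMap.zero_apply]
    | add u v hu hv => simp only [map_add, LinearMap.add_apply, hu, hv]
    | tmul a s =>
    induction y using TensorProduct.induction_on with
    | zero => simp only [map_zero]
    | add u v hu hv => simp only [map_add, hu, hv]
    | tmul b t =>
      rw [extendEquiv_tmul, extendEquiv_tmul, polar_baseChange_tmul, polar_baseChange_tmul]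
      congr 1
      change Sg'.n (e s + e t) - Sg'.n (e s) - Sg'.n (e t) = Sg.n (s + t) - Sg.n s - Sg.n t
      rw [← map_add, he.map_n, he.map_n, he.map_n]
  refine ⟨fun l => rfl, fun l x => ?_, 1, fun x => ?_, fun x y => ?_⟩
  · induction x using TensorProduct.induction_on with
    | zero => simp
    | add u v hu hv => simp only [smul_add, map_add, hu, hv]
    | tmul a s => simp [TensorProduct.smul_tmul']
  · have h := hpol x x
    rw [polar_self, polar_self] at h
    have h' := mul_left_cancel₀ (two_ne_zero_of_invertible F L) h
    change Sg'.n.baseChange L _ = A.ρ (1 : Lˣ) * (A.ρ ^ 2) (1 : Lˣ) * Sg.n.baseChange L x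
    rw [h']
    simp
  · change Sg'.inducedMul A.ρ _ _ = (1 : L) • _root_.extendEquiv L e (Sg.inducedMul A.ρ x y)
    rw [one_smul]
    induction x using TensorProduct.induction_on with
    | zero => simp
    | add u v hu hv => simp only [map_add, LinearMap.add_apply, hu, hv]
    | tmul a s =>
    induction y using TensorProduct.induction_on with
    | zero => simp
    | add u v hu hv => simp only [map_add, hu, hv]
    | tmul b t => simp [inducedMul_apply, he.map_mul]

/-- The conjugating element is Int(f' (Id ⊗ e) f⁻¹), since Id ⊗ e commutes with ρ ⊗ Id. -/
theorem exists_conj_tau {f : L ⊗[F] S ≃ₗ[F] V}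
    (hf : (Sg.tensor Γ.toCubicAlgebraWithAut).IsLinearIsotopy Γ f) {f' : L ⊗[F] S' ≃ₗ[F] V}
    (hf' : (Sg'.tensor Γ.toCubicAlgebraWithAut).IsLinearIsotopy Γ f') (h : Sg.Isomorphic Sg') :
    ∃ φ ∈ Γ.autEnd, tau hf' = φ * tau hf * φ⁻¹ := by
  obtain ⟨e, he⟩ := h
  have hφ := (CyclicComposition.IsIsotopy.symm hf).trans
    (CyclicComposition.IsIsotopy.trans (he.extendEquiv Γ.toCubicAlgebraWithAut) hf')
  have hs : ∀ x, (hatMap S Γ.ρ).symm ((extendEquiv L e).symm x)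
      = (extendEquiv L e).symm ((hatMap S' Γ.ρ).symm x) := fun x => by
    rw [LinearEquiv.symm_apply_eq, LinearEquiv.symm_apply_eq, extendEquiv_hatMap,
      LinearEquiv.apply_symm_apply, LinearEquiv.apply_symm_apply]
  refine ⟨_, CyclicComposition.semilinearInt_mem_autEnd hφ, ?_⟩
  rw [eq_mul_inv_iff_mul_eq]
  ext g x
  obtain ⟨x, rfl⟩ := f'.surjective x
  simp [AlgEquiv.mul_apply, tau_apply, semilinearInt_apply, extendEquiv_hatMap, hs]

/-- An automorphism of order 3 of `End Γ` that restricts to `ρ` comes from a symmetric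
composition. -/
theorem exists_eq_tau (τ : Module.End L V ≃ₐ[F] Module.End L V) (hτ : τ ∈ Γ.autEnd)
    (hρ : ∀ l : L, τ (algebraMap L (Module.End L V) l) = algebraMap L (Module.End L V) (Γ.ρ l))
    (h3 : τ ^ 3 = 1) :
    ∃ (W : Submodule F V) (Sg : SymmetricComposition F W) (f : L ⊗[F] W ≃ₗ[F] V)
      (hf : (Sg.tensor Γ.toCubicAlgebraWithAut).IsLinearIsotopy Γ f), τ = tau hf := by
  obtain ⟨t, ht, rfl⟩ := exists_eq_semilinearInt Γ.ρ τ hρ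
  obtain ⟨c, hc, hQ⟩ := CyclicComposition.exists_similitude_of_sigma ht hτ.1
  have hAB := CyclicComposition.mul_mul_of_mem_autEnd ht hc hQ hτ
  obtain ⟨μ, hm⟩ := CyclicComposition.exists_mul_eq_smul ht hc hQ (fun x y z => (hAB x y z).1)
    (fun x y z => (hAB x y z).2)
  obtain ⟨hμ, hcμ⟩ := CyclicComposition.multiplier_eq hc hQ hm
  have ht3 := CyclicComposition.apply_apply_apply_eq ht hm h3
  have hμ1 : Γ.ρ μ ≠ 0 := by simpa using hμ
  have hμ2 : Γ.ρ (Γ.ρ μ) ≠ 0 := by simpa using hμ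
  -- Dividing by μ cancels t³ = μ ρ(μ) ρ²(μ) by semilinearity.
  let s : V ≃ₗ[F] V :=
    t.trans ((LinearEquiv.smulOfNeZero L V μ⁻¹ (inv_ne_zero hμ)).restrictScalars F)
  have hst : ∀ x, s x = μ⁻¹ • t x := fun _ => rfl
  have hs : ∀ (l : L) (x : V), s (l • x) = Γ.ρ l • s x := fun l x => by
    rw [hst, hst, ht, smul_comm]
  have hs3 : ∀ x, s (s (s x)) = x := fun x => by
    simp only [hst, ht, ht3, smul_smul, map_mul, map_inv₀]
    convert one_smul L x
    field_simp
  obtain ⟨Sg, f, hf, hfs⟩ := CyclicComposition.exists_symmetricComposition hs hs3 hμ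
    (fun x y => by
      simp only [hst, Γ.smul_mul, Γ.mul_smul_right, hm, smul_smul, map_inv₀]
      congr 1
      field_simp)
    (fun x => by
      rw [hst, QuadraticMap.map_smul, hQ, map_mul, hcμ, smul_eq_mul]
      field_simp)
  refine ⟨_, Sg, f, hf, ?_⟩
  rw [CyclicComposition.tau_eq_semilinearInt hf hs hfs]
  ext g x
  obtain ⟨x, rfl⟩ := s.surjective x
  -- Conjugation by s and by t agree on End_L V because scalars are central there.
  have hx : t.symm (s x) = Γ.ρ.symm μ⁻¹ • x := by
    rw [LinearEquiv.symm_apply_eq, ht, AlgEquiv.apply_symm_apply, hst]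
  rw [semilinearInt_apply, semilinearInt_apply, LinearEquiv.symm_apply_apply, hx, map_smul, ht,
    AlgEquiv.apply_symm_apply, hst]

end Automorphisms
theorem mainTheorem1 {F : Type u} {L : Type v} {V : Type w} [Field F]
    [Invertible (2 : F)] [Field L] [Algebra F L] [AddCommGroup V] [Module F V] [Module L V]
    [IsScalarTower F L V] (Γ : CyclicComposition F L V) :
    (∀ (S : Type s) [AddCommGroup S] [Module F S] (Sg : SymmetricComposition F S)
        (f : L ⊗[F] S ≃ₗ[F] V)
        (hf : (Sg.tensor Γ.toCubicAlgebraWithAut).IsLinearIsotopy Γ f),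
        tau hf ∈ Γ.autEnd ∧ tau hf ^ 3 = 1 ∧
        ∀ l : L, tau hf (algebraMap L (Module.End L V) l) =
          algebraMap L (Module.End L V) (Γ.ρ l)) ∧
    (∀ (S : Type s) [AddCommGroup S] [Module F S] (Sg : SymmetricComposition F S)
        (S' : Type s') [AddCommGroup S'] [Module F S'] (Sg' : SymmetricComposition F S')
        (f : L ⊗[F] S ≃ₗ[F] V)
        (hf : (Sg.tensor Γ.toCubicAlgebraWithAut).IsLinearIsotopy Γ f)
        (f' : L ⊗[F] S' ≃ₗ[F] V)
        (hf' : (Sg'.tensor Γ.toCubicAlgebraWithAut).IsLinearIsotopy Γ f'),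
        Sg.Isomorphic Sg' → ∃ φ ∈ Γ.autEnd, tau hf' = φ * tau hf * φ⁻¹) ∧
    (∀ τ ∈ Γ.autEnd,
        (∀ l : L, τ (algebraMap L (Module.End L V) l) =
          algebraMap L (Module.End L V) (Γ.ρ l)) →
        τ ^ 3 = 1 →
        Γ.IsInduced ∧
        ∃ (S : Type w) (_ : AddCommGroup S) (_ : Module F S) (Sg : SymmetricComposition F S)
          (f : L ⊗[F] S ≃ₗ[F] V)
          (hf : (Sg.tensor Γ.toCubicAlgebraWithAut).IsLinearIsotopy Γ f),
          τ = tau hf) := by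
 
  refine ⟨fun S _ _ Sg f hf => ⟨tau_mem_autEnd hf, tau_pow_three hf, tau_algebraMap hf⟩,
    fun S _ _ Sg S' _ _ Sg' f hf f' hf' h => exists_conj_tau hf hf' h, fun τ hτ hρ h3 => ?_⟩
  obtain ⟨W, Sg, f, hf, h⟩ := exists_eq_tau τ hτ hρ h3
  exact ⟨⟨W, _, _, Sg, _, f, hf⟩, W, _, _, Sg, f, hf, h⟩
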